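/- Work in classical first-order logic with equality, in the language $\{\in\}$ of set theory. The $\Delta_0^{\mathcal P}$-formulas are the smallest class of formulas that contains the atomic formulas ($x\in y$, $x=y$) and is closed under $\wedge,\vee,\to,\neg$ and the bounded quantifiers $\forall x\in a$, $\exists x\in a$, $\forall x\subseteq a$, $\exists x\subseteq a$. A $\Sigma_1^{\mathcal P}$-formula (respectively $\Pi_1^{\mathcal P}$-formula) is a formula $\exists u\,S$ (respectively $\forall u\,S$) with $S$ a $\Delta_0^{\mathcal P}$-formula. Let $\mathrm{KP}^{\mathcal P}$ (Mathias' version) be the theory whose axioms are Extensionality, Pairing, Union, Infinity, Powerset, $\Delta_0^{\mathcal P}$-Separation $$\exists x\,\forall u\,[u\in x\leftrightarrow (u\in a\wedge\varphi(u))],$$ $\Delta_0^{\mathcal P}$-Collection $$\forall x\in a\,\exists y\,G(x,y)\to\exists z\,\forall x\in a\,\exists y\in z\,G(x,y)$$ (for $\Delta_0^{\mathcal P}$-formulas $\varphi$, $G$, with parameters), and Set Induction $$\forall x\,[(\forall y\in x\;\theta(y))\to\theta(x)]\to\forall x\,\theta(x)$$ for $\Sigma_1^{\mathcal P}$-formulas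 $\theta$ (with parameters). Let $\mathrm{AC}$ be the axiom of choice: for every set $a$ of nonempty sets there is a function $f$ with domain $a$ such that $f(x)\in x$ for all $x\in a$. **Lemma.** $\mathrm{KP}^{\mathcal P}+\mathrm{AC}\vdash\Pi_1^{\mathcal P}$ set induction; that is, for every $\Pi_1^{\mathcal P}$-formula $\theta(x)$, possibly with parameters, $\mathrm{KP}^{\mathcal P}+\mathrm{AC}$ proves (the universal closure of) $$\forall x\,[(\forall y\in x\;\theta(y))\to\theta(x)]\to\forall x\,\theta(x).$$ -/

import Mathlib

open FirstOrder FirstOrder.Language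

/-! ### Provability in first-order logic with equality -/

/-- `instantiate φ t` is the formula `φ[t/x]`, where `x` is the only bound variable in scope of `φ`. -/
def FirstOrder.Language.BoundedFormula.instantiate {L : Language} {α : Type*}
    (φ : L.BoundedFormula α 1) (t : L.Term α) : L.Formula α :=
  φ.toFormula.subst (Sum.elim Term.var fun _ => t)

/-- `φ` is a propositional tautology: it is true under every assignment of truth values to formulas
that respects `⊥` and `⟹` (the other connectives are defined from these two). -/
def FirstOrder.Language.BoundedFormula.IsTautology {L : Language} {α : Type*} {n : ℕ}
    (φ : L.BoundedFormula α n) : Prop :=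
  ∀ v : L.BoundedFormula α n → Prop,
    ¬ v ⊥ → (∀ ψ χ, v (ψ ⟹ χ) ↔ (v ψ → v χ)) → v φ

/-- A Hilbert calculus for classical first-order logic with equality. The free variables of
formulas are named by natural numbers; `T.Derives φ` says that `φ` has a formal derivation from
the axioms (sentences) in `T`. -/
inductive FirstOrder.Language.Theory.Derives {L : Language} (T : L.Theory) :
    L.Formula ℕ → Prop
  | ax (σ : L.Sentence) (h : σ ∈ T) : Derives T (Formula.relabel Empty.elim σ)
  | taut (φ : L.Formula ℕ) (h : φ.IsTautology) : Derives T φ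
  | mp (φ ψ : L.Formula ℕ) (h₁ : Derives T (φ ⟹ ψ)) (h₂ : Derives T φ) : Derives T ψ
  | all_elim (φ : L.BoundedFormula ℕ 1) (t : L.Term ℕ) : Derives T (∀' φ ⟹ φ.instantiate t)
  | all_intro (ψ : L.Formula ℕ) (φ : L.BoundedFormula ℕ 1) (a : ℕ)
      (hψ : a ∉ ψ.freeVarFinset) (hφ : a ∉ φ.freeVarFinset)
      (h : Derives T (ψ ⟹ φ.instantiate (Term.var a))) : Derives T (ψ ⟹ ∀' φ)
  | eq_refl (t : L.Term ℕ) : Derives T (t.equal t)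
  | eq_subst (φ : L.BoundedFormula ℕ 1) (s t : L.Term ℕ) :
      Derives T (s.equal t ⟹ φ.instantiate s ⟹ φ.instantiate t)

/-- `T.Proves σ` is `T ⊢ σ`. -/
def FirstOrder.Language.Theory.Proves {L : Language} (T : L.Theory) (σ : L.Sentence) : Prop :=
  T.Derives (Formula.relabel Empty.elim σ)

/-- The universal closure of a formula with free variables `0, …, k - 1`. -/
def FirstOrder.Language.Formula.closure {L : Language} {k : ℕ} (φ : L.Formula (Fin k)) :
    L.Sentence :=
  BoundedFormula.alls (n := k) (BoundedFormula.relabel Sum.inr φ)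

namespace PowerKP

/-! ### The language of set theory -/

/-- The only non-logical symbol: the binary relation symbol `∈`. -/
inductive SetRel : ℕ → Type
  | mem : SetRel 2

/-- The language of set theory. -/
def LSet : Language := ⟨fun _ => Empty, SetRel⟩

/-- The symbol `∈`. -/
def memSymb : LSet.Relations 2 := SetRel.mem

variable {α : Type} {n : ℕ}

/-- The variable bound by the innermost quantifier. -/
def new : α ⊕ Fin (n + 1) := Sum.inr (Fin.last n)

/-- A variable, seen below one more quantifier. -/
def up (x : α ⊕ Fin n) : α ⊕ Fin (n + 1) := Sum.map id Fin.castSucc x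

/-- `x ∈ y` -/
def memF (x y : α ⊕ Fin n) : LSet.BoundedFormula α n :=
  memSymb.boundedFormula₂ (Term.var x) (Term.var y)

/-- `x = y` -/
def eqF (x y : α ⊕ Fin n) : LSet.BoundedFormula α n :=
  Term.bdEqual (Term.var x) (Term.var y)

/-- `∀ z, z ∈ x → z ∈ y` -/
def subF (x y : α ⊕ Fin n) : LSet.BoundedFormula α n :=
  ∀' (memF new (up x) ⟹ memF new (up y))

/-- `∀ z ∈ a, φ` -/
def ballMem (a : α ⊕ Fin n) (φ : LSet.BoundedFormula α (n + 1)) : LSet.BoundedFormula α n :=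
  ∀' (memF new (up a) ⟹ φ)

/-- `∃ z ∈ a, φ` -/
def bexMem (a : α ⊕ Fin n) (φ : LSet.BoundedFormula α (n + 1)) : LSet.BoundedFormula α n :=
  ∃' (memF new (up a) ⊓ φ)

/-- `∀ z ⊆ a, φ` -/
def ballSub (a : α ⊕ Fin n) (φ : LSet.BoundedFormula α (n + 1)) : LSet.BoundedFormula α n :=
  ∀' (subF new (up a) ⟹ φ)

/-- `∃ z ⊆ a, φ` -/
def bexSub (a : α ⊕ Fin n) (φ : LSet.BoundedFormula α (n + 1)) : LSet.BoundedFormula α n :=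
  ∃' (subF new (up a) ⊓ φ)

/-- The `Δ₀^P`-formulas. The connectives `∼`, `⊓`, `⊔` are defined from `⊥` and `⟹`. -/
inductive IsDelta0P : ∀ {n : ℕ}, LSet.BoundedFormula α n → Prop
  | falsum {n : ℕ} : IsDelta0P (⊥ : LSet.BoundedFormula α n)
  | mem {n : ℕ} (x y : α ⊕ Fin n) : IsDelta0P (memF x y)
  | eq {n : ℕ} (x y : α ⊕ Fin n) : IsDelta0P (eqF x y)
  | imp {n : ℕ} {φ ψ : LSet.BoundedFormula α n} :
      IsDelta0P φ → IsDelta0P ψ → IsDelta0P (φ ⟹ ψ)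
  | ballMem {n : ℕ} (a : α ⊕ Fin n) {φ : LSet.BoundedFormula α (n + 1)} :
      IsDelta0P φ → IsDelta0P (ballMem a φ)
  | bexMem {n : ℕ} (a : α ⊕ Fin n) {φ : LSet.BoundedFormula α (n + 1)} :
      IsDelta0P φ → IsDelta0P (bexMem a φ)
  | ballSub {n : ℕ} (a : α ⊕ Fin n) {φ : LSet.BoundedFormula α (n + 1)} :
      IsDelta0P φ → IsDelta0P (ballSub a φ)
  | bexSub {n : ℕ} (a : α ⊕ Fin n) {φ : LSet.BoundedFormula α (n + 1)} :
      IsDelta0P φ → IsDelta0P (bexSub a φ)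

/-- The `Σ₁^P`-formulas `∃ u, S` with `S` a `Δ₀^P`-formula. -/
def IsSigma1P (φ : LSet.BoundedFormula α n) : Prop :=
  ∃ S : LSet.BoundedFormula α (n + 1), IsDelta0P S ∧ φ = ∃' S

/-- The `Π₁^P`-formulas `∀ u, S` with `S` a `Δ₀^P`-formula. -/
def IsPi1P (φ : LSet.BoundedFormula α n) : Prop :=
  ∃ S : LSet.BoundedFormula α (n + 1), IsDelta0P S ∧ φ = ∀' S

/-! ### Single axioms -/

/-- The bound variable of level `i`. -/
def bv (i : Fin n) : α ⊕ Fin n := Sum.inr i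

/-- `∀ x y, (∀ z, z ∈ x ↔ z ∈ y) → x = y` -/
def extensionality : LSet.Sentence :=
  ∀' ∀' (∀' (memF (bv 2) (bv 0) ⇔ memF (bv 2) (bv 1)) ⟹ eqF (bv 0) (bv 1))

/-- `∀ x y, ∃ z, ∀ w, w ∈ z ↔ w = x ∨ w = y` -/
def pairing : LSet.Sentence :=
  ∀' ∀' ∃' ∀' (memF (bv 3) (bv 2) ⇔ (eqF (bv 3) (bv 0) ⊔ eqF (bv 3) (bv 1)))

/-- `∀ x, ∃ z, ∀ w, w ∈ z ↔ ∃ y ∈ x, w ∈ y` -/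
def union : LSet.Sentence :=
  ∀' ∃' ∀' (memF (bv 2) (bv 1) ⇔ bexMem (bv 0) (memF (bv 2) (bv 3)))

/-- `∃ x, (∃ e ∈ x, ∀ z, z ∉ e) ∧ ∀ y ∈ x, ∃ s ∈ x, ∀ z, z ∈ s ↔ z ∈ y ∨ z = y` -/
def infinity : LSet.Sentence :=
  ∃' (bexMem (bv 0) (∀' ∼(memF (bv 2) (bv 1))) ⊓
    ballMem (bv 0) (bexMem (bv 0)
      (∀' (memF (bv 3) (bv 2) ⇔ (memF (bv 3) (bv 1) ⊔ eqF (bv 3) (bv 1))))))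

/-- `∀ x, ∃ z, ∀ w, w ∈ z ↔ w ⊆ x` -/
def powerset : LSet.Sentence :=
  ∀' ∃' ∀' (memF (bv 2) (bv 1) ⇔ subF (bv 2) (bv 0))

/-- `p = {x, y}` -/
def isPair (p x y : α ⊕ Fin n) : LSet.BoundedFormula α n :=
  ∀' (memF new (up p) ⇔ (eqF new (up x) ⊔ eqF new (up y)))

/-- `p = ⟨x, y⟩ = {{x}, {x, y}}` -/
def isOrdPair (p x y : α ⊕ Fin n) : LSet.BoundedFormula α n :=
  ∃' ∃' (isPair (bv (Fin.last n).castSucc) (up (up x)) (up (up x)) ⊓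
    isPair new (up (up x)) (up (up y)) ⊓
    isPair (up (up p)) (bv (Fin.last n).castSucc) new)

/-- `⟨x, y⟩ ∈ f` -/
def appF (f x y : α ⊕ Fin n) : LSet.BoundedFormula α n :=
  bexMem f (isOrdPair new (up x) (up y))

/-- `f` is a function: a set of ordered pairs that is single valued. -/
def isFunction (f : α ⊕ Fin n) : LSet.BoundedFormula α n :=
  ballMem f (∃' ∃' isOrdPair (up (up new)) (up new) new) ⊓
  ∀' ∀' ∀' ((appF (up (up (up f))) (up (up new)) (up new) ⊓
    appF (up (up (up f))) (up (up new)) new) ⟹ eqF (up new) new)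

/-- `f` is a function with domain `a`. -/
def isFunctionOn (f a : α ⊕ Fin n) : LSet.BoundedFormula α n :=
  isFunction f ⊓ ∀' (memF new (up a) ⇔ ∃' appF (up (up f)) (up new) new)

/-- The axiom of choice: for every set `a` of nonempty sets there is a function `f` with domain `a`
such that `f(x) ∈ x` for all `x ∈ a`. -/
def choice : LSet.Sentence :=
  ∀' (ballMem (bv 0) (∃' memF (bv 2) (bv 1)) ⟹
    ∃' (isFunctionOn (bv 1) (bv 0) ⊓
      ballMem (bv 0) (bexMem (bv 2) (appF (bv 1) (bv 2) (bv 3)))))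

/-! ### Axiom schemes

In an instance of a scheme, the formula may contain parameters, which are named by `α`. In a formula
with `m` bound variables in scope, `liftAt 1 0` renames them from `0, …, m - 1` to `1, …, m`, so
that the variable of level `0` does not occur in it. -/

/-- `∃ x, ∀ u, u ∈ x ↔ u ∈ a ∧ φ(u)` -/
def separationInst (a : α) (φ : LSet.BoundedFormula α 1) : LSet.Formula α :=
  ∃' ∀' (memF (bv 1) (bv 0) ⇔ (memF (bv 1) (Sum.inl a) ⊓ φ.liftAt 1 0))

/-- `(∀ x ∈ a, ∃ y, G(x, y)) → ∃ z, ∀ x ∈ a, ∃ y ∈ z, G(x, y)` -/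
def collectionInst (a : α) (G : LSet.BoundedFormula α 2) : LSet.Formula α :=
  ballMem (Sum.inl a) (∃' G) ⟹
    ∃' ballMem (Sum.inl a) (bexMem (bv 0) (G.liftAt 1 0))

/-- `(∀ x, (∀ y ∈ x, θ(y)) → θ(x)) → ∀ x, θ(x)` -/
def setInductionInst (θ : LSet.BoundedFormula α 1) : LSet.Formula α :=
  ∀' (ballMem (bv 0) (θ.liftAt 1 0) ⟹ θ) ⟹ ∀' θ

/-- All universal closures of instances of `Δ₀^P`-Separation. -/
def delta0PSeparation : LSet.Theory :=
  {σ | ∃ (k : ℕ) (a : Fin k) (φ : LSet.BoundedFormula (Fin k) 1),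
    IsDelta0P φ ∧ σ = (separationInst a φ).closure}

/-- All universal closures of instances of `Δ₀^P`-Collection. -/
def delta0PCollection : LSet.Theory :=
  {σ | ∃ (k : ℕ) (a : Fin k) (G : LSet.BoundedFormula (Fin k) 2),
    IsDelta0P G ∧ σ = (collectionInst a G).closure}

/-- All universal closures of instances of set induction for `Σ₁^P`-formulas. -/
def sigma1PSetInduction : LSet.Theory :=
  {σ | ∃ (k : ℕ) (θ : LSet.BoundedFormula (Fin k) 1),
    IsSigma1P θ ∧ σ = (setInductionInst θ).closure}

/-- All universal closures of instances of set induction for `Π₁^P`-formulas. -/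
def pi1PSetInduction : LSet.Theory :=
  {σ | ∃ (k : ℕ) (θ : LSet.BoundedFormula (Fin k) 1),
    IsPi1P θ ∧ σ = (setInductionInst θ).closure}

/-- Mathias' theory `KP^P`, in which set induction is restricted to `Σ₁^P`-formulas. -/
def KPP : LSet.Theory :=
  {extensionality, pairing, union, infinity, powerset} ∪
    delta0PSeparation ∪ delta0PCollection ∪ sigma1PSetInduction

/-- `KP^P + AC` -/
def KPPAC : LSet.Theory := KPP ∪ {choice}

end PowerKP

/-! By a Henkin completeness theorem (`proves_of_forall_models`) it suffices to verify the induction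
in every model. Let `Q` be Δ₀^P-definable, let `∀ w, Q x w` be progressive in `x`, and suppose that
`Q x w` fails. Fix a level `a` of the cumulative hierarchy containing `x`; it is transitive. By
progressiveness a failure at a point of `a` forces a failure at one of its elements, and Collection
over `a` gathers witnesses of these new failures in one set (`exists_next`). Iterate this along a
nonempty set, each element of which lies in another one, and let `W` be the union of the values. The
points of `a` whose failure is witnessed in `W` then form a nonempty class without an ∈-minimal
element, against Δ₀^P-foundation (`pi_induction`).

The obstacle is the iteration: Collection bounds witnesses but does not select them. Levels give a
canonical selection. They are Δ₀^P-definable, any two are comparable (`Lev.sub_or_mem`), and every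
set lies in one (`exists_lev`). The value at `c` is an ∈-minimal level bounding the values at the
elements of `c`; comparability makes it unique. Hence partial solutions agree (`Attempt.eq_of_maps`)
and can be glued, and Σ₁^P-induction gives one defined at any given point (`exists_attempt_dom`).

Every predicate fed to Separation, Collection or induction must be Δ₀^P; this dictates the coding of
functions and the bounded reformulations below. -/

namespace FirstOrder.Language

/-! ### Renaming of variables -/

/-- Extend a renaming of variables below one more quantifier. -/
def liftRen {α β : Type*} {n m : ℕ} (f : α ⊕ Fin n → β ⊕ Fin m) :
    α ⊕ Fin (n + 1) → β ⊕ Fin (m + 1) :=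
  Sum.elim (fun a => Sum.map id Fin.castSucc (f (Sum.inl a)))
    (Fin.lastCases (Sum.inr (Fin.last m)) fun i => Sum.map id Fin.castSucc (f (Sum.inr i)))

theorem liftRen_comp {α β γ : Type*} {n m k : ℕ} (f : α ⊕ Fin n → β ⊕ Fin m)
    (g : β ⊕ Fin m → γ ⊕ Fin k) : liftRen g ∘ liftRen f = liftRen (g ∘ f) := by
  have key : ∀ y, liftRen g (Sum.map id Fin.castSucc y) = Sum.map id Fin.castSucc (g y) := by
    rintro (y | y) <;> simp [liftRen]
  funext x
  rcases x with a | i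
  · exact key _
  · induction i using Fin.lastCases with
    | last => simp [liftRen]
    | cast i => simpa [liftRen] using key (f (Sum.inr i))

theorem liftRen_id {α : Type*} {n : ℕ} : liftRen (id : α ⊕ Fin n → α ⊕ Fin n) = id := by
  funext x
  rcases x with a | i
  · rfl
  · induction i using Fin.lastCases <;> simp [liftRen]

namespace BoundedFormula

variable {L : Language} {α β γ : Type*}

/-- Rename free and bound variables simultaneously. -/
def ren : ∀ {n m : ℕ}, L.BoundedFormula α n → (α ⊕ Fin n → β ⊕ Fin m) → L.BoundedFormula β m
  | _, _, falsum, _ => falsum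
  | _, _, equal t₁ t₂, f => equal (t₁.relabel f) (t₂.relabel f)
  | _, _, rel R ts, f => rel R fun i => (ts i).relabel f
  | _, _, imp φ ψ, f => imp (φ.ren f) (ψ.ren f)
  | _, _, all φ, f => all (φ.ren (liftRen f))

theorem ren_ren {n m k : ℕ} (φ : L.BoundedFormula α n) (f : α ⊕ Fin n → β ⊕ Fin m)
    (g : β ⊕ Fin m → γ ⊕ Fin k) : (φ.ren f).ren g = φ.ren (g ∘ f) := by
  induction φ generalizing m k with
  | falsum => rfl
  | equal => simp [ren]
  | rel => simp [ren]
  | imp _ _ h₁ h₂ => simp [ren, h₁, h₂]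
  | all _ h => simp [ren, h, liftRen_comp]

theorem ren_id {n : ℕ} (φ : L.BoundedFormula α n) : φ.ren id = φ := by
  induction φ with
  | falsum => rfl
  | equal => simp [ren]
  | rel => simp [ren]
  | imp _ _ h₁ h₂ => simp [ren, h₁, h₂]
  | all _ h => simp [ren, h, liftRen_id]

theorem liftRen_relabelAux {n : ℕ} (g : α → β ⊕ Fin n) (k : ℕ) :
    liftRen (relabelAux g k) = relabelAux g (k + 1) := by
  funext x
  rcases x with a | i
  · rcases h : g a with b | j
    · simp [liftRen, relabelAux, h]
    · simp only [liftRen, relabelAux, h, Sum.elim_inl, Function.comp_apply, Sum.map_inl]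
      rfl
  · induction i using Fin.lastCases with
    | last => simp [liftRen, relabelAux]
    | cast i => simp [liftRen, relabelAux]

theorem relabel_eq_ren {n k : ℕ} (g : α → β ⊕ Fin n) (φ : L.BoundedFormula α k) :
    φ.relabel g = φ.ren (relabelAux g k) := by
  induction φ with
  | falsum => rfl
  | equal => rfl
  | rel => rfl
  | imp _ _ h₁ h₂ => rw [relabel_imp, h₁, h₂]; rfl
  | all _ h => rw [relabel_all, h, ren, liftRen_relabelAux]

theorem liftRen_map (g : α → β) (n : ℕ) :
    liftRen (Sum.map g id : α ⊕ Fin n → β ⊕ Fin n) = Sum.map g id := by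
  funext x
  rcases x with a | i
  · rfl
  · induction i using Fin.lastCases <;> simp [liftRen]

theorem subst_var_eq_ren {n : ℕ} (g : α → β) (φ : L.BoundedFormula α n) :
    φ.subst (fun a => Term.var (g a)) = φ.ren (Sum.map g id) := by
  have key : ∀ {n : ℕ} (t : L.Term (α ⊕ Fin n)),
      t.subst (Sum.elim (Term.relabel Sum.inl ∘ fun a => Term.var (g a)) (Term.var ∘ Sum.inr)) =
        t.relabel (Sum.map g id) := by
    intro n t
    induction t with
    | var x => rcases x with a | i <;> rfl
    | func f ts ih => simp only [Term.subst, Term.relabel, ih]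
  induction φ with
  | falsum => rfl
  | equal => simp [subst, mapTermRel, ren, key]
  | rel => simp [subst, mapTermRel, ren, key]
  | imp _ _ h₁ h₂ => simp only [subst, mapTermRel, ren] at *; rw [h₁, h₂]
  | all _ h => simp only [subst, mapTermRel, ren, liftRen_map] at *; rw [← h]; rfl

theorem toFormula_eq_ren {n : ℕ} (φ : L.BoundedFormula α n) :
    φ.toFormula = φ.ren (Sum.inl : α ⊕ Fin n → (α ⊕ Fin n) ⊕ Fin 0) := by
  induction φ with
  | falsum => rfl
  | equal => rfl
  | rel => rfl
  | imp _ _ h₁ h₂ => simp only [toFormula, ren, h₁, h₂]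
  | @all n φ h =>
    simp only [toFormula, ren, h, relabel_eq_ren, ren_ren]
    congr 2
    funext x
    rcases x with a | i
    · rfl
    · induction i using Fin.lastCases with
      | last => simp [liftRen, relabelAux, Fin.fin_one_eq_zero]
      | cast i => simp [liftRen, relabelAux]

/-- Instantiation is built from `toFormula` and `subst`. Written as a single renaming it composes by
`ren_ren`, which the quantifier case of the truth lemma needs. -/
theorem instantiate_var_eq_ren (φ : L.BoundedFormula α 1) (a : α) :
    φ.instantiate (Term.var a) = φ.ren (Sum.elim Sum.inl fun _ => Sum.inl a) := by
  have h : (Sum.elim Term.var fun _ => Term.var a : α ⊕ Fin 1 → L.Term α) =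
      fun x => Term.var (Sum.elim id (fun _ => a) x) := by
    funext x
    rcases x with x | x <;> rfl
  rw [instantiate, h, subst_var_eq_ren, toFormula_eq_ren, ren_ren]
  congr 1
  funext x
  rcases x with x | x <;> rfl

theorem ren_all_instantiate {n : ℕ} (φ : L.BoundedFormula α (n + 1)) (xs : Fin n → α) (a : α) :
    (φ.ren (liftRen (Sum.elim Sum.inl fun i => Sum.inl (xs i) :
      α ⊕ Fin n → α ⊕ Fin 0))).instantiate (Term.var a) =
    φ.ren (Sum.elim Sum.inl fun i => Sum.inl ((Fin.snoc xs a : Fin (n + 1) → α) i)) := by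
  rw [instantiate_var_eq_ren, ren_ren]
  congr 1
  funext x
  rcases x with x | i
  · rfl
  · induction i using Fin.lastCases <;> simp [liftRen]

end BoundedFormula

/-! ### Completeness of the Hilbert calculus -/

namespace Theory

variable {L : Language} {T : L.Theory}

/-- The formula `γ` is consistent with `T`. -/
def Consis (T : L.Theory) (γ : L.Formula ℕ) : Prop := ¬ T.Derives (γ ⟹ ⊥)

theorem val_not {v : L.Formula ℕ → Prop} (hb : ¬ v ⊥)
    (hi : ∀ ψ χ : L.Formula ℕ, v (ψ ⟹ χ) ↔ (v ψ → v χ)) (φ : L.Formula ℕ) :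
    v (∼φ) ↔ ¬ v φ :=
  (hi φ ⊥).trans ⟨fun h h' => hb (h h'), fun h h' => (h h').elim⟩

theorem val_inf {v : L.Formula ℕ → Prop} (hb : ¬ v ⊥)
    (hi : ∀ ψ χ : L.Formula ℕ, v (ψ ⟹ χ) ↔ (v ψ → v χ)) (φ ψ : L.Formula ℕ) :
    v (φ ⊓ ψ) ↔ v φ ∧ v ψ := by
  refine (val_not hb hi (φ ⟹ ∼ψ)).trans ?_
  rw [hi, val_not hb hi]
  tauto

theorem Derives.of_taut {φ ψ : L.Formula ℕ} (h₁ : T.Derives φ) (h : (φ ⟹ ψ).IsTautology) :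
    T.Derives ψ :=
  .mp _ _ (.taut _ h) h₁

theorem Derives.of_taut₂ {φ ψ χ : L.Formula ℕ} (h₁ : T.Derives φ) (h₂ : T.Derives ψ)
    (h : (φ ⟹ ψ ⟹ χ).IsTautology) : T.Derives χ :=
  .mp _ _ (.mp _ _ (.taut _ h) h₁) h₂

/-- A single formula has finitely many free variables and `T` consists of sentences, so a fresh
variable can serve as Henkin witness and no new constants are needed. If the extension were
inconsistent, `all_intro` at that variable would derive `∀' ψ`. -/
theorem Consis.exists_not_all {γ : L.Formula ℕ} {ψ : L.BoundedFormula ℕ 1}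
    (h : T.Consis (γ ⊓ ∼(∀' ψ))) :
    ∃ a : ℕ, T.Consis ((γ ⊓ ∼(∀' ψ)) ⊓ ∼(ψ.instantiate (Term.var a))) := by
  obtain ⟨a, ha⟩ := Infinite.exists_notMem_finset
    ((γ ⊓ ∼(∀' ψ) : L.Formula ℕ).freeVarFinset ∪ ψ.freeVarFinset)
  rw [Finset.mem_union, not_or] at ha
  refine ⟨a, fun hd => h ?_⟩
  refine Derives.of_taut (.all_intro _ ψ a ha.1 ha.2 (hd.of_taut ?_)) ?_
  · intro v hb hi
    simp only [hi, val_not hb hi, val_inf hb hi]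
    tauto
  · intro v hb hi
    simp only [hi, val_not hb hi, val_inf hb hi]
    tauto

theorem Consis.extend {γ : L.Formula ℕ} (h : T.Consis γ) (φ : L.Formula ℕ) :
    ∃ γ', T.Consis γ' ∧ T.Derives (γ' ⟹ γ) ∧ (T.Derives (γ' ⟹ φ) ∨
      T.Derives (γ' ⟹ ∼φ) ∧ ∀ ψ : L.BoundedFormula ℕ 1, φ = ∀' ψ →
        ∃ a : ℕ, T.Derives (γ' ⟹ ∼(ψ.instantiate (Term.var a)))) := by
  by_cases h₁ : T.Consis (γ ⊓ φ)
  · refine ⟨_, h₁, .taut _ ?_, Or.inl (.taut _ ?_)⟩ <;>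
    · intro v hb hi
      simp only [hi, val_inf hb hi]
      tauto
  have h₂ : T.Consis (γ ⊓ ∼φ) := by
    intro h₂
    refine h ((not_not.1 h₁).of_taut₂ h₂ ?_)
    intro v hb hi
    simp only [hi, val_not hb hi, val_inf hb hi]
    tauto
  by_cases hφ : ∃ ψ : L.BoundedFormula ℕ 1, φ = ∀' ψ
  · obtain ⟨ψ, rfl⟩ := hφ
    obtain ⟨a, ha⟩ := h₂.exists_not_all
    refine ⟨_, ha, .taut _ ?_, Or.inr ⟨.taut _ ?_, fun ψ' e => ⟨a, .taut _ ?_⟩⟩⟩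
    iterate 2
      intro v hb hi
      simp only [hi, val_not hb hi, val_inf hb hi]
      tauto
    cases e
    intro v hb hi
    simp only [hi, val_not hb hi, val_inf hb hi]
    tauto
  · refine ⟨_, h₂, .taut _ ?_, Or.inr ⟨.taut _ ?_, fun ψ e => (hφ ⟨ψ, e⟩).elim⟩⟩ <;>
    · intro v hb hi
      simp only [hi, val_not hb hi, val_inf hb hi]
      tauto

/-- A complete consistent set of formulas that contains `T` and in which every failing universal
formula fails at some variable. -/
structure IsHenkin (T : L.Theory) (S : Set (L.Formula ℕ)) : Prop where
  of_derives : ∀ {φ}, T.Derives φ → φ ∈ S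
  mp : ∀ {φ ψ}, (φ ⟹ ψ) ∈ S → φ ∈ S → ψ ∈ S
  bot_notMem : ⊥ ∉ S
  mem_or_not : ∀ φ, φ ∈ S ∨ ∼φ ∈ S
  witness : ∀ {ψ : L.BoundedFormula ℕ 1}, ∀' ψ ∉ S → ∃ a : ℕ, ψ.instantiate (Term.var a) ∉ S

/-- Along an enumeration of all formulas, `Consis.extend` yields a chain of single consistent
formulas, each implying its predecessor. The Henkin set consists of the consequences of members of
this chain. -/
theorem Consis.exists_isHenkin [Countable L.Symbols] {γ : L.Formula ℕ} (h : T.Consis γ) :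
    ∃ S, T.IsHenkin S ∧ γ ∈ S := by
  obtain ⟨e, he⟩ := exists_surjective_nat (L.Formula ℕ)
  choose f hf₁ hf₂ hf₃ using fun (p : {γ // T.Consis γ}) (φ : L.Formula ℕ) => p.2.extend φ
  let g : ℕ → {γ // T.Consis γ} := fun n =>
    Nat.rec ⟨γ, h⟩ (fun n p => ⟨f p (e n), hf₁ p (e n)⟩) n
  have hstep : ∀ n, T.Derives ((g (n + 1)).1 ⟹ (g n).1) := fun n => hf₂ (g n) (e n)
  have hmono : ∀ m n, m ≤ n → T.Derives ((g n).1 ⟹ (g m).1) := by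
    intro m n hmn
    induction n, hmn using Nat.le_induction with
    | base => exact .taut _ fun v hb hi => by simp [hi]
    | succ n _ ih =>
      refine (hstep n).of_taut₂ ih ?_
      intro v hb hi
      simp only [hi]
      tauto
  have hand : ∀ {φ ψ χ : L.Formula ℕ}, (∃ n, T.Derives ((g n).1 ⟹ φ)) →
      (∃ n, T.Derives ((g n).1 ⟹ ψ)) → (φ ⟹ ψ ⟹ χ).IsTautology →
      ∃ n, T.Derives ((g n).1 ⟹ χ) := by
    rintro φ ψ χ ⟨m, hm⟩ ⟨n, hn⟩ hχ
    refine ⟨max m n, ?_⟩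
    have h₁ : T.Derives ((g (max m n)).1 ⟹ φ) := by
      refine (hmono m _ (le_max_left m n)).of_taut₂ hm ?_
      intro v hb hi
      simp only [hi]
      tauto
    have h₂ : T.Derives ((g (max m n)).1 ⟹ ψ) := by
      refine (hmono n _ (le_max_right m n)).of_taut₂ hn ?_
      intro v hb hi
      simp only [hi]
      tauto
    refine h₁.of_taut₂ h₂ ?_
    intro v hb hi
    have := hχ v hb hi
    simp only [hi] at this ⊢
    tauto
  have hbot : ¬ ∃ n, T.Derives ((g n).1 ⟹ ⊥) := fun ⟨n, hn⟩ => (g n).2 hn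
  have hdec : ∀ φ, ∃ n, T.Derives ((g n).1 ⟹ φ) ∨
      T.Derives ((g n).1 ⟹ ∼φ) ∧ ∀ ψ : L.BoundedFormula ℕ 1, φ = ∀' ψ →
        ∃ a : ℕ, T.Derives ((g n).1 ⟹ ∼(ψ.instantiate (Term.var a))) := by
    intro φ
    obtain ⟨n, rfl⟩ := he φ
    exact ⟨n + 1, hf₃ (g n) (e n)⟩
  have hcons : ∀ φ, (∃ n, T.Derives ((g n).1 ⟹ ∼φ)) → ¬ ∃ n, T.Derives ((g n).1 ⟹ φ) := by
    refine fun φ h₁ h₂ => hbot (hand h₁ h₂ ?_)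
    intro v hb hi
    simp only [hi, val_not hb hi]
    tauto
  refine ⟨{φ | ∃ n, T.Derives ((g n).1 ⟹ φ)}, ⟨?_, ?_, hbot, ?_, ?_⟩, 0, ?_⟩
  · refine fun hφ => ⟨0, hφ.of_taut ?_⟩
    intro v hb hi
    simp only [hi]
    tauto
  · refine fun h₁ h₂ => hand h₁ h₂ ?_
    intro v hb hi
    simp only [hi]
    tauto
  · intro φ
    obtain ⟨n, hn | hn⟩ := hdec φ
    exacts [Or.inl ⟨n, hn⟩, Or.inr ⟨n, hn.1⟩]
  · intro ψ hψ
    obtain ⟨n, hn | hn⟩ := hdec (∀' ψ)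
    · exact (hψ ⟨n, hn⟩).elim
    · obtain ⟨a, ha⟩ := hn.2 ψ rfl
      exact ⟨a, hcons _ ⟨n, ha⟩⟩
  · exact .taut _ fun v hb hi => by simp [g, hi]

/-! ### The term model and the truth lemma -/

namespace IsHenkin

variable {S : Set (L.Formula ℕ)} (hS : T.IsHenkin S)
include hS

theorem imp_mem_iff {φ ψ : L.Formula ℕ} : (φ ⟹ ψ) ∈ S ↔ (φ ∈ S → ψ ∈ S) := by
  refine ⟨hS.mp, fun h => ?_⟩
  rcases hS.mem_or_not φ with h₁ | h₁
  · refine hS.mp (hS.of_derives (.taut _ ?_)) (h h₁)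
    intro v hb hi
    simp only [hi]
    tauto
  · refine hS.mp (hS.of_derives (.taut _ ?_)) h₁
    intro v hb hi
    simp only [hi, val_not hb hi]
    tauto

theorem all_mem_iff {ψ : L.BoundedFormula ℕ 1} :
    ∀' ψ ∈ S ↔ ∀ a : ℕ, ψ.instantiate (Term.var a) ∈ S := by
  refine ⟨fun h a => hS.mp (hS.of_derives (.all_elim ψ _)) h, fun h => ?_⟩
  by_contra hn
  obtain ⟨a, ha⟩ := hS.witness hn
  exact ha (h a)

theorem ren_subst {a b : ℕ} (h : (Term.var a : L.Term ℕ).equal (Term.var b) ∈ S)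
    (φ : L.BoundedFormula ℕ 1)
    (hφ : φ.ren (Sum.elim Sum.inl fun _ => Sum.inl a : ℕ ⊕ Fin 1 → ℕ ⊕ Fin 0) ∈ S) :
    φ.ren (Sum.elim Sum.inl fun _ => Sum.inl b : ℕ ⊕ Fin 1 → ℕ ⊕ Fin 0) ∈ S := by
  rw [← BoundedFormula.instantiate_var_eq_ren] at hφ ⊢
  exact hS.mp (hS.mp (hS.of_derives (.eq_subst φ _ _)) h) hφ

/-- Variables are identified when their equality is in the Henkin set. -/
def setoid : Setoid ℕ where
  r a b := (Term.var a : L.Term ℕ).equal (Term.var b) ∈ S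
  iseqv :=
    { refl := fun _ => hS.of_derives (.eq_refl _)
      symm := fun {a _} h => hS.ren_subst h
        (Term.bdEqual (Term.var (Sum.inr 0)) (Term.var (Sum.inl a)))
        (hS.of_derives (.eq_refl (Term.var a)))
      trans := fun {a _ _} h₁ h₂ => hS.ren_subst h₂
        (Term.bdEqual (Term.var (Sum.inl a)) (Term.var (Sum.inr 0))) h₁ }

theorem rel_congr {k : ℕ} (R : L.Relations k) {xs ys : Fin k → ℕ}
    (h : ∀ i, (Term.var (xs i) : L.Term ℕ).equal (Term.var (ys i)) ∈ S)
    (hR : R.formula (fun i => Term.var (xs i)) ∈ S) :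
    R.formula (fun i => Term.var (ys i)) ∈ S := by
  -- `eq_subst` replaces one variable at a time: after `j` steps the arguments in positions below
  -- `j` have been exchanged.
  have key : ∀ j ≤ k, R.formula (fun i => Term.var (if i.1 < j then ys i else xs i)) ∈ S := by
    intro j
    induction j with
    | zero => simpa using hR
    | succ j ih =>
      intro hj
      have := hS.ren_subst (h ⟨j, hj⟩) (R.boundedFormula fun i => Term.var
        (if i.1 = j then Sum.inr 0 else if i.1 < j then Sum.inl (ys i) else Sum.inl (xs i))) ?_
      · convert this using 1
        simp only [Relations.formula, Relations.boundedFormula, BoundedFormula.ren, Term.relabel]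
        congr 1
        funext i
        rcases lt_trichotomy i.1 j with hi | hi | hi
        · simp [hi, hi.ne, hi.trans (Nat.lt_succ_self j)]
        · obtain rfl : i = ⟨j, hj⟩ := Fin.ext hi
          simp
        · simp [hi.ne', not_lt.2 hi.le, not_lt.2 (Nat.succ_le_of_lt hi)]
      · convert ih (Nat.le_of_succ_le hj) using 1
        simp only [Relations.formula, Relations.boundedFormula, BoundedFormula.ren, Term.relabel]
        congr 1
        funext i
        rcases lt_trichotomy i.1 j with hi | hi | hi
        · simp [hi, hi.ne]
        · obtain rfl : i = ⟨j, hj⟩ := Fin.ext hi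
          simp
        · simp [hi.ne', not_lt.2 hi.le]
  simpa using key k le_rfl

/-- The term model: variables modulo provable equality. -/
def Model : Type := Quotient hS.setoid

/-- The class of a variable in the term model. -/
def cls (a : ℕ) : hS.Model := Quotient.mk hS.setoid a

instance : Nonempty hS.Model := ⟨hS.cls 0⟩

theorem cls_eq_cls {a b : ℕ} :
    hS.cls a = hS.cls b ↔ (Term.var a : L.Term ℕ).equal (Term.var b) ∈ S :=
  Quotient.eq (r := hS.setoid)

theorem cls_out (x : hS.Model) : hS.cls (Quotient.out x) = x := Quotient.out_eq x

variable [L.IsRelational]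

noncomputable instance : L.Structure hS.Model where
  funMap f := isEmptyElim f
  RelMap R xs := R.formula (fun i => Term.var (Quotient.out (xs i))) ∈ S

theorem relMap_cls {k : ℕ} (R : L.Relations k) (xs : Fin k → ℕ) :
    Structure.RelMap R (fun i => hS.cls (xs i)) ↔ R.formula (fun i => Term.var (xs i)) ∈ S :=
  ⟨hS.rel_congr R fun _ => hS.cls_eq_cls.1 (hS.cls_out _),
    hS.rel_congr R fun _ => hS.cls_eq_cls.1 (hS.cls_out _).symm⟩

theorem mem_iff_realize {n : ℕ} (φ : L.BoundedFormula ℕ n) (xs : Fin n → ℕ) :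
    φ.ren (Sum.elim Sum.inl fun i => Sum.inl (xs i) : ℕ ⊕ Fin n → ℕ ⊕ Fin 0) ∈ S ↔
      φ.Realize hS.cls (hS.cls ∘ xs) := by
  have ht : ∀ {n : ℕ} (t : L.Term (ℕ ⊕ Fin n)), ∃ x, t = Term.var x := by
    rintro n (x | ⟨f, _⟩)
    exacts [⟨x, rfl⟩, isEmptyElim f]
  have hv : ∀ {n : ℕ} (xs : Fin n → ℕ) (x : ℕ ⊕ Fin n),
      (Term.var x : L.Term _).realize (Sum.elim hS.cls (hS.cls ∘ xs)) =
        hS.cls (Sum.elim id xs x) := by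
    rintro n xs (x | x) <;> rfl
  have hr : ∀ {n : ℕ} (xs : Fin n → ℕ) (x : ℕ ⊕ Fin n),
      (Sum.elim Sum.inl (fun i => Sum.inl (xs i)) x : ℕ ⊕ Fin 0) =
        Sum.inl (Sum.elim id xs x) := by
    rintro n xs (x | x) <;> rfl
  induction φ with
  | falsum => exact iff_of_false hS.bot_notMem id
  | equal t₁ t₂ =>
    obtain ⟨x, rfl⟩ := ht t₁
    obtain ⟨y, rfl⟩ := ht t₂
    simp only [BoundedFormula.Realize, hv, cls_eq_cls, BoundedFormula.ren, Term.relabel, hr]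
    rfl
  | rel R ts =>
    choose x hx using fun i => ht (ts i)
    obtain rfl : ts = fun i => Term.var (x i) := funext hx
    simp only [BoundedFormula.Realize, hv, relMap_cls, BoundedFormula.ren, Term.relabel, hr]
    rfl
  | imp φ ψ h₁ h₂ =>
    exact hS.imp_mem_iff.trans ((imp_congr (h₁ xs) (h₂ xs)).trans BoundedFormula.realize_imp.symm)
  | all φ h =>
    rw [BoundedFormula.realize_all, BoundedFormula.ren, hS.all_mem_iff]
    simp only [BoundedFormula.ren_all_instantiate, h]
    refine ⟨fun H x => ?_, fun H a => ?_⟩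
    · have := H (Quotient.out x)
      rwa [Fin.comp_snoc, hS.cls_out] at this
    · rw [Fin.comp_snoc]
      exact H _

theorem mem_iff_formula_realize (φ : L.Formula ℕ) : φ ∈ S ↔ φ.Realize hS.cls := by
  have := hS.mem_iff_realize φ Fin.elim0
  rw [Formula.Realize, ← Subsingleton.elim (hS.cls ∘ Fin.elim0) default, ← this]
  convert Iff.rfl
  conv_rhs => rw [← φ.ren_id]
  congr 1
  funext x
  rcases x with x | x
  · rfl
  · exact x.elim0

end IsHenkin

/-- Completeness of the Hilbert calculus for countable relational languages. -/
theorem proves_of_forall_models [Countable L.Symbols] [L.IsRelational] {σ : L.Sentence}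
    (h : ∀ (M : Type) [L.Structure M] [Nonempty M], M ⊨ T → M ⊨ σ) : T.Proves σ := by
  by_contra hσ
  have hc : T.Consis (∼(Formula.relabel Empty.elim σ)) := by
    refine fun hd => hσ (hd.of_taut ?_)
    intro v hb hi
    simp only [hi, val_not hb hi]
    tauto
  obtain ⟨S, hS, hmem⟩ := hc.exists_isHenkin
  have key : ∀ τ : L.Sentence, Formula.relabel Empty.elim τ ∈ S ↔ hS.Model ⊨ τ := by
    intro τ
    rw [hS.mem_iff_formula_realize, Formula.realize_relabel, Sentence.Realize,
      Subsingleton.elim (hS.cls ∘ Empty.elim) default]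
  have h₁ := h hS.Model ⟨fun τ hτ => (key τ).1 (hS.of_derives (.ax τ hτ))⟩
  exact hS.bot_notMem (hS.mp hmem ((key σ).2 h₁))

end Theory
end FirstOrder.Language

theorem FirstOrder.Language.BoundedFormula.realize_ren {L : Language} {α β M : Type*}
    [L.Structure M] {n m : ℕ} (φ : L.BoundedFormula α n) (f : α ⊕ Fin n → β ⊕ Fin m)
    (v : β → M) (xs : Fin m → M) :
    (φ.ren f).Realize v xs ↔
      φ.Realize (fun a => Sum.elim v xs (f (Sum.inl a))) fun i => Sum.elim v xs (f (Sum.inr i)) := by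
  have hf : ∀ {n m : ℕ} (f : α ⊕ Fin n → β ⊕ Fin m) (xs : Fin m → M),
      Sum.elim v xs ∘ f =
        Sum.elim (fun a => Sum.elim v xs (f (Sum.inl a))) fun i => Sum.elim v xs (f (Sum.inr i)) := by
    intro n m f xs
    funext x
    rcases x with x | x <;> rfl
  induction φ generalizing m with
  | falsum => rfl
  | equal => simp [ren, Realize, hf]
  | rel => simp [ren, Realize, hf]
  | imp _ _ h₁ h₂ => simp only [ren, Realize, h₁, h₂]
  | all φ h =>
    simp only [ren, Realize, h]
    refine forall_congr' fun a => ?_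
    have hs : ∀ y : β ⊕ Fin m, Sum.elim v (Fin.snoc xs a : Fin (m + 1) → M)
        (Sum.map id Fin.castSucc y) = Sum.elim v xs y := by
      rintro (y | y) <;> simp
    have h₁ : (fun x => Sum.elim v (Fin.snoc xs a : Fin (m + 1) → M) (liftRen f (Sum.inl x))) =
        fun x => Sum.elim v xs (f (Sum.inl x)) := funext fun x => hs _
    have h₂ : (fun i => Sum.elim v (Fin.snoc xs a : Fin (m + 1) → M) (liftRen f (Sum.inr i))) =
        Fin.snoc (fun i => Sum.elim v xs (f (Sum.inr i))) a := by
      funext i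
      induction i using Fin.lastCases with
      | last => simp [liftRen]
      | cast i => simp [liftRen, hs]
    rw [h₁, h₂]

namespace PowerKP

instance : LSet.IsRelational := fun _ => inferInstanceAs (IsEmpty Empty)

instance : Countable LSet.Symbols := by
  have h : ∀ x y : Σ l, LSet.Relations l, x = y := by
    rintro ⟨_, x⟩ ⟨_, y⟩
    cases x
    cases y
    rfl
  have : Countable (Σ l, LSet.Relations l) := Function.Injective.countable (f := fun _ => 0)
    fun x y _ => h x y
  exact inferInstanceAs (Countable ((Σ l, LSet.Functions l) ⊕ Σ l, LSet.Relations l))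

/-! ### Definability by `Δ₀^P`-formulas with parameters -/

section Realize

variable {α M : Type} {n : ℕ} (v : α → M) (xs : Fin n → M)

@[simp]
theorem elim_up (a : M) (x : α ⊕ Fin n) :
    Sum.elim v (Fin.snoc xs a : Fin (n + 1) → M) (up x) = Sum.elim v xs x := by
  rcases x with x | x <;> simp [up]

@[simp]
theorem elim_new (a : M) : Sum.elim v (Fin.snoc xs a : Fin (n + 1) → M) new = a := by
  simp [new]

variable [LSet.Structure M]

/-- Membership in a structure for the language of set theory. -/
def E (x y : M) : Prop := Structure.RelMap memSymb ![x, y]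

/-- Inclusion in a structure for the language of set theory. -/
def Sub (x y : M) : Prop := ∀ z, E z x → E z y

@[simp]
theorem realize_memF (x y : α ⊕ Fin n) :
    (memF x y).Realize v xs ↔ E (Sum.elim v xs x) (Sum.elim v xs y) := by
  simp [memF, E]

@[simp]
theorem realize_eqF (x y : α ⊕ Fin n) :
    (eqF x y).Realize v xs ↔ Sum.elim v xs x = Sum.elim v xs y := by
  simp [eqF]

@[simp]
theorem realize_subF (x y : α ⊕ Fin n) :
    (subF x y).Realize v xs ↔ Sub (Sum.elim v xs x) (Sum.elim v xs y) := by
  simp [subF, Sub]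

@[simp]
theorem realize_ballMem (a : α ⊕ Fin n) (φ : LSet.BoundedFormula α (n + 1)) :
    (ballMem a φ).Realize v xs ↔ ∀ z, E z (Sum.elim v xs a) → φ.Realize v (Fin.snoc xs z) := by
  simp [ballMem]

@[simp]
theorem realize_bexMem (a : α ⊕ Fin n) (φ : LSet.BoundedFormula α (n + 1)) :
    (bexMem a φ).Realize v xs ↔ ∃ z, E z (Sum.elim v xs a) ∧ φ.Realize v (Fin.snoc xs z) := by
  simp [bexMem]

@[simp]
theorem realize_ballSub (a : α ⊕ Fin n) (φ : LSet.BoundedFormula α (n + 1)) :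
    (ballSub a φ).Realize v xs ↔ ∀ z, Sub z (Sum.elim v xs a) → φ.Realize v (Fin.snoc xs z) := by
  simp [ballSub]

@[simp]
theorem realize_bexSub (a : α ⊕ Fin n) (φ : LSet.BoundedFormula α (n + 1)) :
    (bexSub a φ).Realize v xs ↔ ∃ z, Sub z (Sum.elim v xs a) ∧ φ.Realize v (Fin.snoc xs z) := by
  simp [bexSub]

end Realize

/-! ### Renaming preserves Δ₀^P-formulas -/

section Ren

variable {α β : Type} {n m : ℕ} (f : α ⊕ Fin n → β ⊕ Fin m)

theorem liftRen_up (x : α ⊕ Fin n) : liftRen f (up x) = up (f x) := by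
  rcases x with x | x <;> simp [liftRen, up]

theorem liftRen_new : liftRen f new = new := by simp [liftRen, new]

theorem ren_memF (x y : α ⊕ Fin n) : (memF x y).ren f = memF (f x) (f y) := by
  simp only [memF, Relations.boundedFormula₂, Relations.boundedFormula, BoundedFormula.ren]
  congr 1
  funext i
  fin_cases i <;> rfl

theorem ren_subF (x y : α ⊕ Fin n) : (subF x y).ren f = subF (f x) (f y) := by
  simp only [subF, BoundedFormula.ren, ren_memF, liftRen_up, liftRen_new]

theorem ren_inf (φ ψ : LSet.BoundedFormula α n) : (φ ⊓ ψ).ren f = φ.ren f ⊓ ψ.ren f := rfl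

theorem ren_ex (φ : LSet.BoundedFormula α (n + 1)) : (∃' φ).ren f = ∃' φ.ren (liftRen f) := rfl

theorem IsDelta0P.ren {φ : LSet.BoundedFormula α n} (h : IsDelta0P φ) : IsDelta0P (φ.ren f) := by
  induction h generalizing m with
  | falsum => exact .falsum
  | mem x y => rw [ren_memF]; exact .mem _ _
  | eq x y => exact .eq (f x) (f y)
  | imp _ _ h₁ h₂ => exact .imp (h₁ f) (h₂ f)
  | ballMem a _ h =>
    simp only [PowerKP.ballMem, BoundedFormula.ren, ren_memF, liftRen_up, liftRen_new]
    exact .ballMem _ (h _)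
  | bexMem a _ h =>
    simp only [PowerKP.bexMem, ren_ex, ren_inf, ren_memF, liftRen_up, liftRen_new]
    exact .bexMem _ (h _)
  | ballSub a _ h =>
    simp only [PowerKP.ballSub, BoundedFormula.ren, ren_subF, liftRen_up, liftRen_new]
    exact .ballSub _ (h _)
  | bexSub a _ h =>
    simp only [PowerKP.bexSub, ren_ex, ren_inf, ren_subF, liftRen_up, liftRen_new]
    exact .bexSub _ (h _)

end Ren

/-! ### Closure properties of Δ₀^P-definable predicates -/

section Definable

variable {M : Type} {n : ℕ}

/-- `t` is a projection or a constant function. -/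
def IsVar (t : (Fin n → M) → M) : Prop :=
  ∃ x : M ⊕ Fin n, ∀ xs, Sum.elim id xs x = t xs

theorem IsVar.const (c : M) : IsVar fun _ : Fin n → M => c := ⟨Sum.inl c, fun _ => rfl⟩

theorem IsVar.proj (i : Fin n) : IsVar fun xs : Fin n → M => xs i := ⟨Sum.inr i, fun _ => rfl⟩

variable [LSet.Structure M]

/-- `P` is definable by a `Δ₀^P`-formula with parameters in `M`. -/
def DefP (P : (Fin n → M) → Prop) : Prop :=
  ∃ φ : LSet.BoundedFormula M n, IsDelta0P φ ∧ ∀ xs, φ.Realize id xs ↔ P xs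

namespace DefP

variable {P Q : (Fin n → M) → Prop} {s t : (Fin n → M) → M}

theorem congr (h : DefP P) (hPQ : ∀ xs, P xs ↔ Q xs) : DefP Q := by
  obtain ⟨φ, h₁, h₂⟩ := h
  exact ⟨φ, h₁, fun xs => (h₂ xs).trans (hPQ xs)⟩

theorem mem (hs : IsVar s) (ht : IsVar t) : DefP fun xs => E (s xs) (t xs) := by
  obtain ⟨x, hx⟩ := hs
  obtain ⟨y, hy⟩ := ht
  exact ⟨memF x y, .mem x y, fun xs => by simp [hx, hy]⟩

theorem eq (hs : IsVar s) (ht : IsVar t) : DefP fun xs => s xs = t xs := by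
  obtain ⟨x, hx⟩ := hs
  obtain ⟨y, hy⟩ := ht
  exact ⟨eqF x y, .eq x y, fun xs => by simp [hx, hy]⟩

theorem imp (hP : DefP P) (hQ : DefP Q) : DefP fun xs => P xs → Q xs := by
  obtain ⟨φ, h₁, h₂⟩ := hP
  obtain ⟨ψ, h₃, h₄⟩ := hQ
  exact ⟨φ ⟹ ψ, .imp h₁ h₃, fun xs => by simp [h₂, h₄]⟩

theorem not (hP : DefP P) : DefP fun xs => ¬ P xs :=
  hP.imp ⟨⊥, .falsum, fun _ => Iff.rfl⟩

theorem and (hP : DefP P) (hQ : DefP Q) : DefP fun xs => P xs ∧ Q xs :=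
  (hP.imp hQ.not).not.congr fun xs => by tauto

theorem or (hP : DefP P) (hQ : DefP Q) : DefP fun xs => P xs ∨ Q xs :=
  (hP.not.imp hQ).congr fun xs => by tauto

variable {R : (Fin n → M) → M → Prop}

theorem ballMem (ht : IsVar t)
    (h : DefP fun ys : Fin (n + 1) → M => R (Fin.init ys) (ys (Fin.last n))) :
    DefP fun xs => ∀ z, E z (t xs) → R xs z := by
  obtain ⟨x, hx⟩ := ht
  obtain ⟨φ, h₁, h₂⟩ := h
  exact ⟨PowerKP.ballMem x φ, .ballMem x h₁, fun xs => by simp [h₂, hx]⟩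

theorem bexMem (ht : IsVar t)
    (h : DefP fun ys : Fin (n + 1) → M => R (Fin.init ys) (ys (Fin.last n))) :
    DefP fun xs => ∃ z, E z (t xs) ∧ R xs z := by
  obtain ⟨x, hx⟩ := ht
  obtain ⟨φ, h₁, h₂⟩ := h
  exact ⟨PowerKP.bexMem x φ, .bexMem x h₁, fun xs => by simp [h₂, hx]⟩

theorem ballSub (ht : IsVar t)
    (h : DefP fun ys : Fin (n + 1) → M => R (Fin.init ys) (ys (Fin.last n))) :
    DefP fun xs => ∀ z, Sub z (t xs) → R xs z := by
  obtain ⟨x, hx⟩ := ht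
  obtain ⟨φ, h₁, h₂⟩ := h
  exact ⟨PowerKP.ballSub x φ, .ballSub x h₁, fun xs => by simp [h₂, hx]⟩

theorem bexSub (ht : IsVar t)
    (h : DefP fun ys : Fin (n + 1) → M => R (Fin.init ys) (ys (Fin.last n))) :
    DefP fun xs => ∃ z, Sub z (t xs) ∧ R xs z := by
  obtain ⟨x, hx⟩ := ht
  obtain ⟨φ, h₁, h₂⟩ := h
  exact ⟨PowerKP.bexSub x φ, .bexSub x h₁, fun xs => by simp [h₂, hx]⟩

theorem comp {k : ℕ} {P : (Fin k → M) → Prop} (h : DefP P) {t : Fin k → (Fin n → M) → M}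
    (ht : ∀ i, IsVar (t i)) : DefP fun xs => P fun i => t i xs := by
  obtain ⟨φ, h₁, h₂⟩ := h
  choose x hx using ht
  refine ⟨φ.ren (Sum.elim Sum.inl x), h₁.ren _, fun xs => ?_⟩
  rw [BoundedFormula.realize_ren]
  simp only [Sum.elim_inl, Sum.elim_inr, hx]
  exact h₂ _

theorem comp₁ {P : M → Prop} (h : DefP fun v : Fin 1 → M => P (v 0)) (ht : IsVar t) :
    DefP fun xs => P (t xs) :=
  h.comp (t := fun _ => t) fun _ => ht

theorem comp₂ {P : M → M → Prop} (h : DefP fun v : Fin 2 → M => P (v 0) (v 1))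
    (hs : IsVar s) (ht : IsVar t) : DefP fun xs => P (s xs) (t xs) :=
  h.comp (t := ![s, t]) fun i => by fin_cases i <;> assumption

theorem comp₃ {r : (Fin n → M) → M} {P : M → M → M → Prop}
    (h : DefP fun v : Fin 3 → M => P (v 0) (v 1) (v 2))
    (hr : IsVar r) (hs : IsVar s) (ht : IsVar t) : DefP fun xs => P (r xs) (s xs) (t xs) :=
  h.comp (t := ![r, s, t]) fun i => by fin_cases i <;> assumption

theorem sub (hs : IsVar s) (ht : IsVar t) : DefP fun xs => Sub (s xs) (t xs) :=
  comp₂ (P := Sub) (ballMem (.proj 0) (mem (.proj 2) (.proj 1))) hs ht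

/-- The parameters may be collected in a finite tuple, which contains any given element. -/
theorem exists_params (h : DefP P) (a : M) : ∃ (k : ℕ) (p : Fin k → M) (i : Fin k)
    (φ : LSet.BoundedFormula (Fin k) n), p i = a ∧ IsDelta0P φ ∧ ∀ xs, φ.Realize p xs ↔ P xs := by
  classical
  obtain ⟨φ, h₁, h₂⟩ := h
  let s : Finset M := insert a φ.freeVarFinset
  let e := s.equivFin
  have ha : a ∈ s := Finset.mem_insert_self _ _
  -- Elements outside `s` do not occur free in `φ`; the index of `a` is only a default value for
  -- them.
  let g : M → Fin s.card := fun m => if hm : m ∈ s then e ⟨m, hm⟩ else e ⟨a, ha⟩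
  refine ⟨s.card, fun i => (e.symm i).1, e ⟨a, ha⟩, φ.ren (Sum.map g id), by simp, h₁.ren _,
    fun xs => ?_⟩
  rw [BoundedFormula.realize_ren, ← h₂]
  have key : ∀ v : M → M, (φ.restrictFreeVar Subtype.val).Realize v xs ↔ φ.Realize v xs :=
    fun v => BoundedFormula.realize_restrictFreeVar v fun _ => rfl
  refine (key _).symm.trans (BoundedFormula.realize_restrictFreeVar id fun m => ?_)
  have hm : m.1 ∈ s := Finset.mem_insert_of_mem m.2
  simp [g, hm]

end DefP

end Definable

/-! ### The axioms in a model -/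

/-- The part of `KP^P` that is used below, for a structure `M`. -/
structure IsKPP (M : Type) [LSet.Structure M] : Prop where
  ext : ∀ x y : M, (∀ z, E z x ↔ E z y) → x = y
  pair : ∀ x y : M, ∃ z, ∀ w, E w z ↔ w = x ∨ w = y
  union : ∀ x : M, ∃ z, ∀ w, E w z ↔ ∃ y, E y x ∧ E w y
  inf : ∃ x : M, (∃ e, E e x) ∧ ∀ y, E y x → ∃ s, E s x ∧ E y s
  pow : ∀ x : M, ∃ z, ∀ w, E w z ↔ Sub w x
  sep : ∀ {P : M → Prop}, DefP (fun v : Fin 1 → M => P (v 0)) →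
    ∀ a, ∃ x, ∀ u, E u x ↔ E u a ∧ P u
  coll : ∀ {G : M → M → Prop}, DefP (fun v : Fin 2 → M => G (v 0) (v 1)) →
    ∀ a, (∀ x, E x a → ∃ y, G x y) → ∃ z, ∀ x, E x a → ∃ y, E y z ∧ G x y
  ind : ∀ {Q : M → M → Prop}, DefP (fun v : Fin 2 → M => Q (v 0) (v 1)) →
    (∀ x, (∀ y, E y x → ∃ u, Q y u) → ∃ u, Q x u) → ∀ x, ∃ u, Q x u

section Axioms

variable {M : Type} [LSet.Structure M]

theorem realize_closure {k : ℕ} (φ : LSet.Formula (Fin k)) :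
    M ⊨ φ.closure ↔ ∀ v : Fin k → M, φ.Realize v := by
  rw [Sentence.Realize, Formula.closure, BoundedFormula.realize_alls]
  exact forall_congr' fun v => Formula.realize_relabel_sumInr φ

theorem realize_separationInst {k : ℕ} (a : Fin k) (φ : LSet.BoundedFormula (Fin k) 1)
    (v : Fin k → M) : (separationInst a φ).Realize v ↔
      ∃ x, ∀ u, E u x ↔ E u (v a) ∧ φ.Realize v fun _ => u := by
  simp only [separationInst, Formula.Realize, BoundedFormula.realize_ex,
    BoundedFormula.realize_all, BoundedFormula.realize_iff, BoundedFormula.realize_inf,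
    realize_memF, BoundedFormula.realize_liftAt (Nat.zero_le 1)]
  have h : ∀ x u : M, (Fin.snoc (Fin.snoc default x : Fin 1 → M) u : Fin 2 → M) ∘
      (fun i : Fin 1 => if (i : ℕ) < 0 then Fin.castAdd 1 i else Fin.addNat i 1) = fun _ => u := by
    intro x u
    funext i
    fin_cases i
    rfl
  simp only [h]
  rfl

theorem realize_collectionInst {k : ℕ} (a : Fin k) (G : LSet.BoundedFormula (Fin k) 2)
    (v : Fin k → M) : (collectionInst a G).Realize v ↔
      ((∀ x, E x (v a) → ∃ y, G.Realize v ![x, y]) →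
        ∃ z, ∀ x, E x (v a) → ∃ y, E y z ∧ G.Realize v ![x, y]) := by
  simp only [collectionInst, Formula.Realize, BoundedFormula.realize_ex, realize_ballMem,
    BoundedFormula.realize_imp, realize_bexMem, BoundedFormula.realize_liftAt (Nat.zero_le 2)]
  have h₁ : ∀ x y : M, (Fin.snoc (Fin.snoc default x : Fin 1 → M) y : Fin 2 → M) = ![x, y] := by
    intro x y
    funext i
    fin_cases i <;> rfl
  have h₂ : ∀ x y z : M,
      (Fin.snoc (![x, y] : Fin 2 → M) z : Fin 3 → M) ∘
        (fun i : Fin 2 => if (i : ℕ) < 0 then Fin.castAdd 1 i else Fin.addNat i 1) = ![y, z] := by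
    intro x y z
    funext i
    fin_cases i <;> rfl
  simp only [h₁, h₂]
  rfl

theorem realize_setInductionInst {k : ℕ} (θ : LSet.BoundedFormula (Fin k) 1)
    (v : Fin k → M) : (setInductionInst θ).Realize v ↔
      ((∀ x, (∀ y, E y x → θ.Realize v fun _ => y) → θ.Realize v fun _ => x) →
        ∀ x, θ.Realize v fun _ => x) := by
  simp only [setInductionInst, Formula.Realize, BoundedFormula.realize_all, realize_ballMem,
    BoundedFormula.realize_imp, BoundedFormula.realize_liftAt (Nat.zero_le 1)]
  have h₁ : ∀ x : M, (Fin.snoc default x : Fin 1 → M) = fun _ => x := by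
    intro x
    funext i
    fin_cases i
    rfl
  have h₂ : ∀ x u : M, (Fin.snoc (fun _ => x : Fin 1 → M) u : Fin 2 → M) ∘
      (fun i : Fin 1 => if (i : ℕ) < 0 then Fin.castAdd 1 i else Fin.addNat i 1) = fun _ => u := by
    intro x u
    funext i
    fin_cases i
    rfl
  simp only [h₁, h₂]
  rfl

theorem isKPP_of_models (h : M ⊨ KPPAC) : IsKPP M := by
  have hax : ∀ σ ∈ ({extensionality, pairing, union, infinity, powerset} : Set LSet.Sentence),
      M ⊨ σ := fun σ hσ => h.realize_of_mem σ (Or.inl (Or.inl (Or.inl (Or.inl hσ))))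
  have hv : ∀ {n : ℕ} (xs : Fin n → M) (i : Fin n),
    Sum.elim (default : Empty → M) xs (bv i) = xs i := fun _ _ => rfl
  refine ⟨?_, ?_, ?_, ?_, ?_, fun {P} hP a => ?_, fun {G} hG a => ?_, fun {Q} hQ => ?_⟩
  · have := hax extensionality (by simp)
    simp only [extensionality, Sentence.Realize, Formula.Realize, BoundedFormula.realize_all,
      BoundedFormula.realize_imp, BoundedFormula.realize_iff, realize_memF, realize_eqF, hv] at this
    exact this
  · have := hax pairing (by simp)
    simp only [pairing, Sentence.Realize, Formula.Realize, BoundedFormula.realize_all,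
      BoundedFormula.realize_ex, BoundedFormula.realize_sup,
      BoundedFormula.realize_iff, realize_memF, realize_eqF, hv] at this
    exact this
  · have := hax union (by simp)
    simp only [union, Sentence.Realize, Formula.Realize, BoundedFormula.realize_all,
      BoundedFormula.realize_ex, realize_bexMem,
      BoundedFormula.realize_iff, realize_memF, hv] at this
    exact this
  · have := hax infinity (by simp)
    simp only [infinity, Sentence.Realize, Formula.Realize, BoundedFormula.realize_all,
      BoundedFormula.realize_ex, realize_bexMem, realize_ballMem, BoundedFormula.realize_inf,
      BoundedFormula.realize_sup, BoundedFormula.realize_iff, realize_memF, realize_eqF, hv] at this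
    -- Only nonemptiness and the fact that each element lies in another one are kept.
    obtain ⟨x, ⟨e, he, -⟩, hx⟩ := this
    refine ⟨x, ⟨e, he⟩, fun y hy => ?_⟩
    obtain ⟨s, hs, h⟩ := hx y hy
    exact ⟨s, hs, (h y).2 (Or.inr rfl)⟩
  · have := hax powerset (by simp)
    simp only [powerset, Sentence.Realize, Formula.Realize, BoundedFormula.realize_all,
      BoundedFormula.realize_ex, realize_subF,
      BoundedFormula.realize_iff, realize_memF, hv] at this
    exact this
  · obtain ⟨k, p, i, φ, rfl, hφ, hr⟩ := hP.exists_params a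
    have := (realize_closure _).1
      (h.realize_of_mem _ (Or.inl (Or.inl (Or.inl (Or.inr ⟨k, i, φ, hφ, rfl⟩))))) p
    simpa only [realize_separationInst, hr] using this
  · obtain ⟨k, p, i, φ, rfl, hφ, hr⟩ := hG.exists_params a
    have := (realize_closure _).1
      (h.realize_of_mem _ (Or.inl (Or.inl (Or.inr ⟨k, i, φ, hφ, rfl⟩)))) p
    simp only [realize_collectionInst, hr] at this
    exact this
  · intro hQ' x
    obtain ⟨k, p, i, φ, -, hφ, hr⟩ := hQ.exists_params x
    have := (realize_closure _).1
      (h.realize_of_mem _ (Or.inl (Or.inr ⟨k, ∃' φ, ⟨φ, hφ, rfl⟩, rfl⟩))) p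
    simp only [realize_setInductionInst, BoundedFormula.realize_ex, hr] at this
    exact this hQ' x

theorem models_pi1PSetInduction {σ : LSet.Sentence} (hσ : σ ∈ pi1PSetInduction)
    (h : ∀ {Q : M → M → Prop}, DefP (fun v : Fin 2 → M => Q (v 0) (v 1)) →
      (∀ x, (∀ y, E y x → ∀ u, Q y u) → ∀ u, Q x u) → ∀ x u, Q x u) : M ⊨ σ := by
  obtain ⟨k, θ, ⟨S, hS, rfl⟩, rfl⟩ := hσ
  rw [realize_closure]
  intro p
  simp only [realize_setInductionInst, BoundedFormula.realize_all]
  refine h (Q := fun x u => S.Realize p (Fin.snoc (fun _ => x : Fin 1 → M) u : Fin 2 → M))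
    ⟨S.ren (Sum.map p id), hS.ren _, fun xs => ?_⟩
  rw [BoundedFormula.realize_ren]
  convert Iff.rfl using 2
  · rfl
  · exact funext (Fin.forall_fin_two.2 ⟨rfl, rfl⟩)

end Axioms
end PowerKP

namespace PowerKP

/-! ### Foundation and elementary set formation -/

section Basic

variable {M : Type} [LSet.Structure M]

theorem Sub.refl (x : M) : Sub x x := fun _ h => h

theorem Sub.trans {x y z : M} (h₁ : Sub x y) (h₂ : Sub y z) : Sub x z := fun w hw => h₂ w (h₁ w hw)

namespace IsKPP

variable (hM : IsKPP M)
include hM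

/-- Σ₁^P-induction with a dummy existential quantifier. -/
theorem induction {P : M → Prop} (hP : DefP fun v : Fin 1 → M => P (v 0))
    (h : ∀ x, (∀ y, E y x → P y) → P x) (x : M) : P x := by
  obtain ⟨_, hx⟩ := hM.ind (Q := fun x _ => P x) (hP.comp₁ (.proj 0))
    (fun x hx => ⟨x, h x fun y hy => (hx y hy).elim fun _ h => h⟩) x
  exact hx

theorem exists_minimal {P : M → Prop} (hP : DefP fun v : Fin 1 → M => P (v 0)) {x : M} (hx : P x) :
    ∃ y, P y ∧ ∀ z, E z y → ¬ P z := by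
  by_contra! h
  exact hM.induction (P := fun y => ¬ P y) hP.not (fun y hy hPy =>
    (h y hPy).elim fun z hz => hy z hz.1 hz.2) x hx

theorem not_mem_of_mem {x y : M} (hxy : E x y) : ¬ E y x := by
  intro hyx
  obtain ⟨x, ⟨y, h₁, h₂⟩, h⟩ := hM.exists_minimal (P := fun x => ∃ y, E y x ∧ E x y)
    (by apply_rules [DefP.bexMem, DefP.mem, IsVar.proj]) ⟨x, hxy, hyx⟩
  exact h y h₁ ⟨x, h₂, h₁⟩

theorem not_mem_self (x : M) : ¬ E x x := fun h => hM.not_mem_of_mem h h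

theorem eq_of_sub {x y : M} (h₁ : Sub x y) (h₂ : Sub y x) : x = y :=
  hM.ext x y fun z => ⟨h₁ z, h₂ z⟩

theorem exists_union (x y : M) : ∃ z, ∀ w, E w z ↔ E w x ∨ E w y := by
  obtain ⟨p, hp⟩ := hM.pair x y
  obtain ⟨z, hz⟩ := hM.union p
  refine ⟨z, fun w => (hz w).trans ?_⟩
  simp only [hp]
  exact ⟨by rintro ⟨_, rfl | rfl, h⟩ <;> tauto, by rintro (h | h) <;> exact ⟨_, by tauto, h⟩⟩

theorem exists_insert (x y : M) : ∃ z, ∀ w, E w z ↔ E w x ∨ w = y := by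
  obtain ⟨p, hp⟩ := hM.pair y y
  obtain ⟨z, hz⟩ := hM.exists_union x p
  exact ⟨z, fun w => by rw [hz, hp, or_self]⟩

end IsKPP

end Basic

/-! ### The cumulative hierarchy -/

section Levels

variable {M : Type} [LSet.Structure M]

/-- `x` is the set of all subsets of elements of `h ∩ x`. -/
def IsStage (h x : M) : Prop := ∀ y, E y x ↔ ∃ c, E c h ∧ E c x ∧ Sub y c

/-- `s` is a level of the cumulative hierarchy, as witnessed by the set `h` of earlier levels. -/
def Lev (s : M) : Prop := ∃ h, Sub h s ∧ (∀ x, E x h → IsStage h x) ∧ IsStage h s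

/-- The defining equivalence has an unbounded quantifier over `y`. Its two directions separate into
one bounded by `y ∈ x` and one bounded by `y ⊆ c`. -/
theorem DefP.isStage {n : ℕ} {s t : (Fin n → M) → M} (hs : IsVar s) (ht : IsVar t) :
    DefP fun xs => IsStage (s xs) (t xs) := by
  refine comp₂ (P := IsStage) (congr (P := fun v => (∀ y, E y (v 1) → ∃ c, E c (v 0) ∧ E c (v 1) ∧
    Sub y c) ∧ ∀ c, E c (v 0) → E c (v 1) → ∀ y, Sub y c → E y (v 1)) ?_ fun v => ?_) hs ht
  · apply_rules [DefP.ballMem, DefP.bexMem, DefP.ballSub, DefP.and, DefP.imp, DefP.mem, IsVar.proj]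
  · exact ⟨fun h y => ⟨h.1 y, fun ⟨c, h₁, h₂, h₃⟩ => h.2 c h₁ h₂ y h₃⟩,
      fun h => ⟨fun y => (h y).1, fun c h₁ h₂ y h₃ => (h y).2 ⟨c, h₁, h₂, h₃⟩⟩⟩

theorem DefP.lev {n : ℕ} {t : (Fin n → M) → M} (ht : IsVar t) : DefP fun xs => Lev (t xs) := by
  refine comp₁ (P := Lev) ?_ ht
  unfold Lev
  apply_rules [DefP.isStage, DefP.ballMem, DefP.bexSub, DefP.and, IsVar.proj]

namespace Lev

variable {s t x y : M}

theorem mem_of_sub (hs : Lev s) (hx : E x s) (hy : Sub y x) : E y s := by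
  obtain ⟨h, -, -, hs⟩ := hs
  obtain ⟨c, h₁, h₂, h₃⟩ := (hs x).1 hx
  exact (hs y).2 ⟨c, h₁, h₂, hy.trans h₃⟩

theorem sub_of_mem (hs : Lev s) (hx : E x s) : Sub x s := by
  obtain ⟨h, hsub, hh, hs⟩ := hs
  intro z hz
  obtain ⟨c, h₁, h₂, h₃⟩ := (hs x).1 hx
  obtain ⟨c', h₄, h₅, h₆⟩ := (hh c h₁ z).1 (h₃ z hz)
  exact (hs z).2 ⟨c', h₄, hsub c' h₄, h₆⟩

/-- If `h` witnesses that `s` is a level and `y ⊆ c` with `c ∈ h ∩ s`, then `h ∩ c` witnesses that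
`c` is a level. -/
theorem exists_lev_mem (hM : IsKPP M) (hs : Lev s) (hy : E y s) :
    ∃ c, Lev c ∧ E c s ∧ Sub y c := by
  obtain ⟨h, hsub, hh, hs⟩ := hs
  -- Transitivity of the members of `h` ensures that cutting `h` down to `h ∩ c` loses no earlier
  -- stage of any `x ∈ h ∩ c`.
  have htr : ∀ x, E x h → ∀ y, E y x → Sub y x := by
    refine hM.induction
        (by apply_rules [DefP.ballMem, DefP.imp, DefP.mem, IsVar.proj, IsVar.const]) fun x IH hx y hy z hz => ?_
    obtain ⟨c, h₁, h₂, h₃⟩ := (hh x hx y).1 hy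
    obtain ⟨c', h₄, h₅, h₆⟩ := (hh c h₁ z).1 (h₃ z hz)
    exact (hh x hx z).2 ⟨c', h₄, (hh x hx c').2 ⟨c, h₁, h₂, IH c h₂ h₁ c' h₅⟩, h₆⟩
  obtain ⟨c, h₁, h₂, h₃⟩ := (hs y).1 hy
  obtain ⟨h', hh'⟩ := hM.sep (P := fun u => E u c)
      (by apply_rules [DefP.mem, IsVar.proj, IsVar.const]) h
  refine ⟨c, ⟨h', fun z hz => ((hh' z).1 hz).2, fun x hx y => ?_, fun y => ?_⟩, h₂, h₃⟩
  · obtain ⟨hxh, hxc⟩ := (hh' x).1 hx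
    refine (hh x hxh y).trans (exists_congr fun d => ?_)
    rw [hh']
    have := htr c h₁ x hxc d
    tauto
  · refine (hh c h₁ y).trans (exists_congr fun d => ?_)
    rw [hh']
    tauto

/-- If `y ∈ s` is not in `t`, choose a level `c ∈ s` with `y ⊆ c`. No level `d ∈ t` can include `c`,
so all of them lie in `c`; hence `t ⊆ c` and `t ∈ s`. -/
theorem sub_or_mem_of_forall (hM : IsKPP M) (hs : Lev s) (ht : Lev t)
    (H : ∀ c, E c s → Lev c → ∀ d, E d t → Lev d → Sub c d ∨ E d c) : Sub s t ∨ E t s := by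
  by_contra! hn
  obtain ⟨y, hys, hyt⟩ : ∃ y, E y s ∧ ¬ E y t := by
    by_contra! h
    exact hn.1 h
  obtain ⟨c, hc, hcs, hyc⟩ := hs.exists_lev_mem hM hys
  refine hn.2 (hs.mem_of_sub hcs fun z hz => ?_)
  obtain ⟨d, hd, hdt, hzd⟩ := ht.exists_lev_mem hM hz
  rcases H c hcs hc d hdt hd with h | h
  · exact (hyt (ht.mem_of_sub hdt (hyc.trans h))).elim
  · exact hc.mem_of_sub h hzd

theorem sub_or_mem (hM : IsKPP M) (hs : Lev s) (ht : Lev t) : Sub s t ∨ E t s := by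
  -- Restricting `d` to the elements of the fixed level `t` keeps the induction predicate Δ₀^P. As
  -- `t` is transitive, the hypothesis also covers the elements of `d`, so one induction on `s`
  -- suffices.
  have key : ∀ s, Lev s → ∀ d, E d t → Lev d → Sub s d ∨ E d s := by
    refine hM.induction
        (by apply_rules [DefP.lev, DefP.ballMem, DefP.or, DefP.imp, DefP.mem, IsVar.proj,
          IsVar.const]) fun s IH hs d hd hd' => ?_
    exact hs.sub_or_mem_of_forall hM hd' fun c hc hc' d' hd₁ hd₂ =>
      IH c hc hc' d' (ht.sub_of_mem hd _ hd₁) hd₂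
  exact hs.sub_or_mem_of_forall hM ht fun c _ hc d => key c hc d

end Lev

namespace IsKPP

variable (hM : IsKPP M)
include hM

/-- The history is the set `h` of all levels in `z ∪ ⋃ z`, which is closed under levels belonging to
its members. The new level consists of all subsets of members of `h`. -/
theorem exists_lev_of_forall {z : M} (hz : ∀ c, E c z → Lev c) :
    ∃ s, Lev s ∧ ∀ c, E c z → E c s := by
  obtain ⟨u, hu⟩ := hM.union z
  obtain ⟨w, hw⟩ := hM.exists_union z u
  obtain ⟨h, hh⟩ := hM.sep (P := Lev) (by apply_rules [DefP.lev, IsVar.proj]) w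
  obtain ⟨v, hv⟩ := hM.union h
  obtain ⟨p, hp⟩ := hM.pow v
  obtain ⟨s, hs⟩ := hM.sep (P := fun y => ∃ c, E c h ∧ Sub y c)
      (by apply_rules [DefP.bexMem, DefP.sub, IsVar.proj, IsVar.const]) p
  have hs' : ∀ y, E y s ↔ ∃ c, E c h ∧ Sub y c := fun y => (hs y).trans
    ⟨fun h => h.2, fun h => ⟨(hp y).2 fun x hx => (hv x).2 (h.imp fun c hc => ⟨hc.1, hc.2 x hx⟩), h⟩⟩
  have hsub : Sub h s := fun c hc => (hs' c).2 ⟨c, hc, .refl c⟩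
  have hlow : ∀ x c, E x h → E c x → Lev c → E c h := by
    intro x c hx hcx hc
    refine (hh c).2 ⟨(hw c).2 (Or.inr ((hu c).2 ?_)), hc⟩
    rcases (hw x).1 ((hh x).1 hx).1 with h | h
    · exact ⟨x, h, hcx⟩
    · obtain ⟨y, hy, hxy⟩ := (hu x).1 h
      exact ⟨y, hy, (hz y hy).sub_of_mem hxy c hcx⟩
  refine ⟨s, ⟨h, hsub, fun x hx y => ⟨fun hy => ?_, ?_⟩, fun y => (hs' y).trans ?_⟩,
    fun c hc => hsub c ((hh c).2 ⟨(hw c).2 (Or.inl hc), hz c hc⟩)⟩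
  · obtain ⟨c, hc, hcx, hyc⟩ := ((hh x).1 hx).2.exists_lev_mem hM hy
    exact ⟨c, hlow x c hx hcx hc, hcx, hyc⟩
  · rintro ⟨c, -, hcx, hyc⟩
    exact ((hh x).1 hx).2.mem_of_sub hcx hyc
  · exact exists_congr fun c => ⟨fun h => ⟨h.1, hsub c h.1, h.2⟩, fun h => ⟨h.1, h.2.2⟩⟩

/-- Σ₁^P-induction: Collection supplies levels for the elements of `x`, a level `s` above them
includes `x`, and a level containing `s` then contains `x`. -/
theorem exists_lev (x : M) : ∃ s, Lev s ∧ E x s := by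
  refine hM.ind (Q := fun x s => Lev s ∧ E x s)
      (by apply_rules [DefP.lev, DefP.and, DefP.mem, IsVar.proj]) (fun x IH => ?_) x
  obtain ⟨z, hz⟩ := hM.coll (G := fun x s => Lev s ∧ E x s)
      (by apply_rules [DefP.lev, DefP.and, DefP.mem, IsVar.proj]) x IH
  obtain ⟨z', hz'⟩ := hM.sep (P := Lev) (by apply_rules [DefP.lev, IsVar.proj]) z
  obtain ⟨s, hs, hs'⟩ := hM.exists_lev_of_forall fun c hc => ((hz' c).1 hc).2
  obtain ⟨p, hp⟩ := hM.pair s s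
  obtain ⟨t, ht, ht'⟩ := hM.exists_lev_of_forall (z := p) fun c hc => by
    rcases (hp c).1 hc with rfl | rfl <;> exact hs
  refine ⟨t, ht, ht.mem_of_sub (ht' s ((hp s).2 (Or.inl rfl))) fun y hy => ?_⟩
  obtain ⟨u, hu, hu', hyu⟩ := hz y hy
  exact hs.sub_of_mem (hs' u ((hz' u).2 ⟨hu, hu'⟩)) y hyu

end IsKPP

end Levels

/-! ### Induction for `Π₁^P`-formulas -/

section Recursion

variable {M : Type} [LSet.Structure M]

/-- `e = {x, y}` -/
def IsUPair (e x y : M) : Prop := ∀ z, E z e ↔ z = x ∨ z = y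

/-- The partial function coded by `f` maps `c` to `q`. Only values with `c ∈ q` are coded, which
allows for unordered pairs. -/
def Maps (f c q : M) : Prop := E c q ∧ ∃ e, E e f ∧ IsUPair e c q

/-- The partial function coded by `f` is defined at `c`. -/
def Dom (f c : M) : Prop := ∃ q, Maps f c q

theorem Maps.exists_mem {f c q : M} (h : Maps f c q) : ∃ e, E e f ∧ E c e ∧ E q e := by
  obtain ⟨-, e, he, h⟩ := h
  exact ⟨e, he, (h c).2 (Or.inl rfl), (h q).2 (Or.inr rfl)⟩

namespace DefP

variable {n : ℕ} {r s t : (Fin n → M) → M}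

theorem isUPair (hr : IsVar r) (hs : IsVar s) (ht : IsVar t) :
    DefP fun xs => IsUPair (r xs) (s xs) (t xs) := by
  refine comp₃ (P := IsUPair) (congr (P := fun v => E (v 1) (v 0) ∧ E (v 2) (v 0) ∧
    ∀ z, E z (v 0) → z = v 1 ∨ z = v 2) ?_ fun v => ?_) hr hs ht
  · apply_rules [DefP.ballMem, DefP.and, DefP.or, DefP.mem, DefP.eq, IsVar.proj]
  · refine ⟨fun h z => ⟨h.2.2 z, ?_⟩, fun h => ⟨(h _).2 (Or.inl rfl), (h _).2 (Or.inr rfl),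
      fun z => (h z).1⟩⟩
    rintro (rfl | rfl)
    exacts [h.1, h.2.1]

theorem maps (hr : IsVar r) (hs : IsVar s) (ht : IsVar t) :
    DefP fun xs => Maps (r xs) (s xs) (t xs) := by
  refine comp₃ (P := Maps) ?_ hr hs ht
  unfold Maps
  apply_rules [DefP.isUPair, DefP.bexMem, DefP.and, DefP.mem, IsVar.proj]

/-- The value `q` belongs to a pair belonging to `f`, so the quantifier over `q` can be bounded. -/
theorem dom (hs : IsVar s) (ht : IsVar t) : DefP fun xs => Dom (s xs) (t xs) := by
  refine comp₂ (P := Dom) (congr (P := fun v => ∃ e, E e (v 0) ∧ ∃ q, E q e ∧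
    Maps (v 0) (v 1) q) ?_ fun v => ?_) hs ht
  · apply_rules [DefP.maps, DefP.bexMem, IsVar.proj]
  · refine ⟨fun ⟨_, _, q, _, h⟩ => ⟨q, h⟩, fun ⟨q, h⟩ => ?_⟩
    obtain ⟨e, h₁, -, h₂⟩ := h.exists_mem
    exact ⟨e, h₁, q, h₂, h⟩

end DefP

variable (Q : M → M → Prop) (a u : M)

/-- Some element of `p` witnesses the failure of `∀ u, Q x u`. -/
def Fails (p x : M) : Prop := ∃ u, E u p ∧ ¬ Q x u

/-- Below each `x ∈ a` at which `p` witnesses a failure there is a failure witnessed by `q`. -/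
def Next (p q : M) : Prop := ∀ x, E x a → Fails Q p x → ∃ y, E y x ∧ Fails Q q y

/-- The level `q` is an upper bound for the values of `f` at the elements of `c`. -/
def Bound (f c q : M) : Prop :=
  Lev q ∧ E u q ∧ E c q ∧ ∀ d, E d c → ∀ p, Maps f d p → Next Q a p q

/-- `f` is an initial part of the function that maps each `c` to the least upper bound of the values
at the elements of `c`. -/
def Attempt (f : M) : Prop := ∀ c q, Maps f c q →
  (∀ d, E d c → Dom f d) ∧ Bound Q a u f c q ∧ ∀ q', E q' q → ¬ Bound Q a u f c q'

variable {Q a u}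

namespace DefP

variable {n : ℕ} {r s t : (Fin n → M) → M}

theorem fails (hQ : DefP fun v : Fin 2 → M => Q (v 0) (v 1)) (hs : IsVar s) (ht : IsVar t) :
    DefP fun xs => Fails Q (s xs) (t xs) := by
  refine comp₂ (P := Fails Q) ?_ hs ht
  unfold Fails
  apply_rules [hQ.comp₂, DefP.bexMem, DefP.not, IsVar.proj]

theorem next (hQ : DefP fun v : Fin 2 → M => Q (v 0) (v 1)) (hs : IsVar s) (ht : IsVar t) :
    DefP fun xs => Next Q a (s xs) (t xs) := by
  refine comp₂ (P := Next Q a) ?_ hs ht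
  unfold Next
  apply_rules [hQ.fails, DefP.ballMem, DefP.bexMem, DefP.imp, IsVar.proj, IsVar.const]

theorem bound (hQ : DefP fun v : Fin 2 → M => Q (v 0) (v 1))
    (hr : IsVar r) (hs : IsVar s) (ht : IsVar t) :
    DefP fun xs => Bound Q a u (r xs) (s xs) (t xs) := by
  refine comp₃ (P := Bound Q a u) (congr (P := fun v => Lev (v 2) ∧ E u (v 2) ∧ E (v 1) (v 2) ∧
    ∀ d, E d (v 1) → ∀ e, E e (v 0) → ∀ p, E p e → Maps (v 0) d p → Next Q a p (v 2))
    ?_ fun v => ?_) hr hs ht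
  · apply_rules [hQ.next, DefP.lev, DefP.maps, DefP.ballMem, DefP.and, DefP.imp, DefP.mem,
        IsVar.proj, IsVar.const]
  · refine and_congr Iff.rfl (and_congr Iff.rfl (and_congr Iff.rfl (forall₂_congr fun d hd => ?_)))
    refine ⟨fun h p hp => ?_, fun h _ _ p _ => h p⟩
    obtain ⟨e, h₁, -, h₂⟩ := hp.exists_mem
    exact h e h₁ p h₂ hp

theorem attempt (hQ : DefP fun v : Fin 2 → M => Q (v 0) (v 1)) (ht : IsVar t) :
    DefP fun xs => Attempt Q a u (t xs) := by
  refine comp₁ (P := Attempt Q a u) (congr (P := fun v => ∀ e, E e (v 0) → ∀ c, E c e →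
    ∀ q, E q e → Maps (v 0) c q → (∀ d, E d c → Dom (v 0) d) ∧ Bound Q a u (v 0) c q ∧
      ∀ q', E q' q → ¬ Bound Q a u (v 0) c q') ?_ fun v => ?_) ht
  · apply_rules [hQ.bound, DefP.dom, DefP.maps, DefP.ballMem, DefP.and, DefP.not, DefP.imp,
        IsVar.proj]
  · refine ⟨fun h c q hcq => ?_, fun h _ _ c _ q _ => h c q⟩
    obtain ⟨e, h₁, h₂, h₃⟩ := hcq.exists_mem
    exact h e h₁ c h₂ q h₃ hcq

end DefP

/-! ### Uniqueness and gluing of partial solutions -/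

theorem Bound.congr {f g c q : M} (h : ∀ d, E d c → ∀ p, Maps f d p ↔ Maps g d p) :
    Bound Q a u f c q ↔ Bound Q a u g c q :=
  and_congr Iff.rfl (and_congr Iff.rfl (and_congr Iff.rfl
    (forall₂_congr fun d hd => forall_congr' fun p => by rw [h d hd p])))

theorem Attempt.of_forall_exists {g : M}
    (h : ∀ c q, Maps g c q → ∃ f, Attempt Q a u f ∧ Maps f c q ∧ (∀ d, E d c → Dom f d → Dom g d) ∧
      ∀ d, E d c → ∀ p, Maps f d p ↔ Maps g d p) : Attempt Q a u g := by
  intro c q hcq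
  obtain ⟨f, hf, hfc, h₁, h₂⟩ := h c q hcq
  obtain ⟨h₃, h₄, h₅⟩ := hf c q hfc
  exact ⟨fun d hd => h₁ d hd (h₃ d hd), (Bound.congr h₂).1 h₄,
    fun q' hq' hb => h₅ q' hq' ((Bound.congr h₂).2 hb)⟩

/-- By ∈-induction both partial solutions agree below `c`, so both values are ∈-minimal among the
same bounds. Comparability of levels then gives inclusion both ways. -/
theorem Attempt.eq_of_maps (hM : IsKPP M) {f g : M}
    (hf : Attempt Q a u f) (hg : Attempt Q a u g) {c q q' : M}
    (hq : Maps f c q) (hq' : Maps g c q') : q = q' := by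
  -- Running through the pairs in `f` and `g` bounds the quantifiers over the values.
  have key : ∀ c e, E e f → ∀ q, E q e → Maps f c q → ∀ e', E e' g → ∀ q', E q' e' →
      Maps g c q' → q = q' := by
    refine hM.induction
        (by apply_rules [DefP.maps, DefP.ballMem, DefP.imp, DefP.eq, IsVar.proj, IsVar.const])
      fun c IH e _ q _ hq e' _ q' _ hq' => ?_
    have IH' : ∀ d, E d c → ∀ p p', Maps f d p → Maps g d p' → p = p' := by
      intro d hd p p' hp hp'
      obtain ⟨e₁, h₁, -, h₂⟩ := hp.exists_mem
      obtain ⟨e₂, h₃, -, h₄⟩ := hp'.exists_mem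
      exact IH d hd e₁ h₁ p h₂ hp e₂ h₃ p' h₄ hp'
    obtain ⟨hd₁, hb₁, hm₁⟩ := hf c q hq
    obtain ⟨hd₂, hb₂, hm₂⟩ := hg c q' hq'
    have hfg : ∀ d, E d c → ∀ p, Maps f d p ↔ Maps g d p := by
      refine fun d hd p => ⟨fun hp => ?_, fun hp => ?_⟩
      · obtain ⟨p', hp'⟩ := hd₂ d hd
        rwa [IH' d hd p p' hp hp']
      · obtain ⟨p', hp'⟩ := hd₁ d hd
        rwa [← IH' d hd p' p hp' hp]
    refine hM.eq_of_sub ?_ ?_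
    · refine (hb₁.1.sub_or_mem hM hb₂.1).resolve_right fun h => ?_
      exact hm₁ q' h ((Bound.congr hfg).2 hb₂)
    · refine (hb₂.1.sub_or_mem hM hb₁.1).resolve_right fun h => ?_
      exact hm₂ q h ((Bound.congr hfg).1 hb₁)
  obtain ⟨e₁, h₁, -, h₂⟩ := hq.exists_mem
  obtain ⟨e₂, h₃, -, h₄⟩ := hq'.exists_mem
  exact key c e₁ h₁ q h₂ hq e₂ h₃ q' h₄ hq'

namespace IsKPP

variable (hM : IsKPP M)
include hM

/-- The condition `c ∈ q` orients the unordered pair: reading it backwards would produce an ∈-cycle.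
-/
theorem maps_insert_iff {f g e c q c' q' : M} (hcq : E c q) (he : IsUPair e c q)
    (hg : ∀ w, E w g ↔ E w f ∨ w = e) :
    Maps g c' q' ↔ Maps f c' q' ∨ c' = c ∧ q' = q := by
  constructor
  · rintro ⟨h, e', he', hp⟩
    rcases (hg e').1 he' with h' | rfl
    · exact Or.inl ⟨h, e', h', hp⟩
    · refine Or.inr ?_
      rcases (he c').1 ((hp c').2 (Or.inl rfl)) with rfl | rfl <;>
        rcases (he q').1 ((hp q').2 (Or.inr rfl)) with rfl | rfl
      · exact (hM.not_mem_self _ h).elim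
      · exact ⟨rfl, rfl⟩
      · exact (hM.not_mem_of_mem h hcq).elim
      · exact (hM.not_mem_self _ h).elim
  · rintro (⟨h, e', he', hp⟩ | ⟨rfl, rfl⟩)
    · exact ⟨h, e', (hg e').2 (Or.inl he'), hp⟩
    · exact ⟨hcq, e, (hg e).2 (Or.inr rfl), he⟩

variable (hQ : DefP fun v : Fin 2 → M => Q (v 0) (v 1))
include hQ

theorem exists_attempt_of_set (z : M) : ∃ g, Attempt Q a u g ∧
    ∀ f, E f z → Attempt Q a u f → ∀ c q, Maps f c q → Maps g c q := by
  obtain ⟨z', hz'⟩ := hM.sep (P := Attempt Q a u) (by apply_rules [hQ.attempt, IsVar.proj]) z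
  obtain ⟨g, hg⟩ := hM.union z'
  have hsub : ∀ f, E f z → Attempt Q a u f → ∀ c q, Maps f c q → Maps g c q :=
    fun f hf hf' c q ⟨h, e, he, hp⟩ => ⟨h, e, (hg e).2 ⟨f, (hz' f).2 ⟨hf, hf'⟩, he⟩, hp⟩
  have hex : ∀ c q, Maps g c q → ∃ f, E f z ∧ Attempt Q a u f ∧ Maps f c q := by
    rintro c q ⟨h, e, he, hp⟩
    obtain ⟨f, hf, hef⟩ := (hg e).1 he
    exact ⟨f, ((hz' f).1 hf).1, ((hz' f).1 hf).2, h, e, hef, hp⟩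
  refine ⟨g, Attempt.of_forall_exists fun c q hcq => ?_, hsub⟩
  obtain ⟨f, hf, hf', hfc⟩ := hex c q hcq
  refine ⟨f, hf', hfc, fun d _ ⟨p, hp⟩ => ⟨p, hsub f hf hf' d p hp⟩,
    fun d hd p => ⟨hsub f hf hf' d p, fun hp => ?_⟩⟩
  obtain ⟨f', -, h₁, h₂⟩ := hex d p hp
  obtain ⟨p', hp'⟩ := (hf' c q hfc).1 d hd
  rwa [h₁.eq_of_maps hM hf' h₂ hp']

/-! ### Totality of the recursion and the final descent -/

variable (hprog : ∀ x, (∀ y, E y x → ∀ w, Q y w) → ∀ w, Q x w)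
include hprog

/-- The union `v` of `z` contains all witnesses held by members of `z`, so one application of
Collection treats every `p ∈ z`. -/
theorem exists_next (z x y : M) :
    ∃ q, Lev q ∧ E x q ∧ E y q ∧ ∀ p, E p z → Next Q a p q := by
  obtain ⟨v, hv⟩ := hM.union z
  -- The failure hypothesis sits inside the collected predicate, so at points of `a` without a
  -- failure any set will do.
  obtain ⟨t, ht⟩ := hM.coll (G := fun x w => Fails Q v x → ∃ y, E y x ∧ ¬ Q y w)
    (by apply_rules [hQ.comp₂, DefP.bexMem, DefP.not, DefP.imp, IsVar.proj, IsVar.const]) a (by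
      intro x _
      by_cases hx : Fails Q v x
      · obtain ⟨w, -, hw⟩ := hx
        by_contra! h
        exact hw (hprog x (fun y hy w' => (h w').2 y hy) w)
      · exact ⟨x, fun h => (hx h).elim⟩)
  obtain ⟨p₁, h₁⟩ := hM.pair x y
  obtain ⟨p₂, h₂⟩ := hM.pair p₁ t
  obtain ⟨q, hq, hq'⟩ := hM.exists_lev p₂
  have hp₁ := hq.sub_of_mem hq' p₁ ((h₂ p₁).2 (Or.inl rfl))
  have htq := hq.sub_of_mem hq' t ((h₂ t).2 (Or.inr rfl))
  refine ⟨q, hq, hq.sub_of_mem hp₁ x ((h₁ x).2 (Or.inl rfl)),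
    hq.sub_of_mem hp₁ y ((h₁ y).2 (Or.inr rfl)), fun p hp x hx ⟨w, hw, hxw⟩ => ?_⟩
  obtain ⟨w', hw', h⟩ := ht x hx
  obtain ⟨y, hy, hyw⟩ := h ⟨w, (hv w).2 ⟨p, hp, hw⟩, hxw⟩
  exact ⟨y, hy, w', hq.sub_of_mem htq w' hw', hyw⟩

theorem exists_attempt_dom (c : M) : ∃ f, Attempt Q a u f ∧ Dom f c := by
  refine hM.ind (Q := fun c f => Attempt Q a u f ∧ Dom f c)
    (by apply_rules [hQ.attempt, DefP.dom, DefP.and, IsVar.proj]) (fun c IH => ?_) c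
  obtain ⟨z, hz⟩ := hM.coll (G := fun c f => Attempt Q a u f ∧ Dom f c)
    (by apply_rules [hQ.attempt, DefP.dom, DefP.and, IsVar.proj]) c IH
  obtain ⟨g, hg, hsub⟩ := hM.exists_attempt_of_set (a := a) (u := u) hQ z
  have hdom : ∀ d, E d c → Dom g d := by
    intro d hd
    obtain ⟨f, hf, hf', p, hp⟩ := hz d hd
    exact ⟨p, hsub f hf hf' d p hp⟩
  by_cases hc : Dom g c
  · exact ⟨g, hg, hc⟩
  obtain ⟨v, hv⟩ := hM.union g
  obtain ⟨q₀, h₁, h₂, h₃, h₄⟩ := hM.exists_next (a := a) hQ hprog v u c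
  have hb : Bound Q a u g c q₀ := by
    refine ⟨h₁, h₂, h₃, fun d _ p hp => h₄ p ((hv p).2 ?_)⟩
    obtain ⟨e, he, -, hpe⟩ := hp.exists_mem
    exact ⟨e, he, hpe⟩
  obtain ⟨q, hq, hmin⟩ := hM.exists_minimal (P := fun q => Bound Q a u g c q)
    (by apply_rules [hQ.bound, IsVar.proj, IsVar.const]) hb
  obtain ⟨e, he⟩ := hM.pair c q
  obtain ⟨f, hf⟩ := hM.exists_insert g e
  have hins : ∀ {c' q' : M}, Maps f c' q' ↔ Maps g c' q' ∨ c' = c ∧ q' = q :=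
    hM.maps_insert_iff hq.2.2.1 he hf
  refine ⟨f, fun c' q' h => ?_, q, hins.2 (Or.inr ⟨rfl, rfl⟩)⟩
  -- The new pair disturbs no earlier value: elements of an old argument already lie in the domain
  -- of `g`, which `c` does not, and `c ∉ c`.
  have key : (∀ d, E d c' → Dom g d) ∧ Bound Q a u g c' q' ∧
      (∀ q'', E q'' q' → ¬ Bound Q a u g c' q'') ∧ ∀ d, E d c' → d ≠ c := by
    rcases hins.1 h with h | ⟨rfl, rfl⟩
    · obtain ⟨h₁, h₂, h₃⟩ := hg c' q' h
      exact ⟨h₁, h₂, h₃, fun d hd e => hc (e ▸ h₁ d hd)⟩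
    · exact ⟨hdom, hq, hmin, fun d hd e => hM.not_mem_self c' (e ▸ hd)⟩
  obtain ⟨k₁, k₂, k₃, k₄⟩ := key
  have hgf : ∀ d, E d c' → ∀ p, Maps g d p ↔ Maps f d p := fun d hd p => by
    have := k₄ d hd
    rw [hins]
    tauto
  exact ⟨fun d hd => (k₁ d hd).imp fun p hp => (hgf d hd p).1 hp, (Bound.congr hgf).1 k₂,
    fun q'' h₁ h₂ => k₃ q'' h₁ ((Bound.congr hgf).2 h₂)⟩

/-- Set induction for `Π₁^P`-formulas. -/
theorem pi_induction (x w : M) : Q x w := by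
  by_contra hxw
  obtain ⟨a, ha, hxa⟩ := hM.exists_lev x
  obtain ⟨i, ⟨c₀, hc₀⟩, hi⟩ := hM.inf
  obtain ⟨z, hz⟩ := hM.coll (G := fun c f => Attempt Q a w f ∧ Dom f c)
    (by apply_rules [hQ.attempt, DefP.dom, DefP.and, IsVar.proj]) i
    fun c _ => hM.exists_attempt_dom hQ hprog c
  obtain ⟨g, hg, hsub⟩ := hM.exists_attempt_of_set (a := a) (u := w) hQ z
  have hdom : ∀ c, E c i → Dom g c := by
    intro c hc
    obtain ⟨f, hf, hf', p, hp⟩ := hz c hc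
    exact ⟨p, hsub f hf hf' c p hp⟩
  obtain ⟨v, hv⟩ := hM.union g
  obtain ⟨v', hv'⟩ := hM.sep (P := fun q => ∃ c, E c i ∧ Maps g c q)
    (by apply_rules [DefP.maps, DefP.bexMem, IsVar.proj, IsVar.const]) v
  obtain ⟨W, hW⟩ := hM.union v'
  have hmem : ∀ c q y, E c i → Maps g c q → E y q → E y W := by
    intro c q y hc hq hy
    obtain ⟨e, he, -, hqe⟩ := hq.exists_mem
    exact (hW y).2 ⟨q, (hv' q).2 ⟨(hv q).2 ⟨e, he, hqe⟩, c, hc, hq⟩, hy⟩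
  -- Every value contains `w`, so the original failure at `x` is witnessed in `W`.
  obtain ⟨q₀, hq₀⟩ := hdom c₀ hc₀
  obtain ⟨y, ⟨hya, r, hr, hyr⟩, hmin⟩ := hM.exists_minimal (P := fun y => E y a ∧ Fails Q W y)
    (by apply_rules [DefP.bexMem, DefP.and, DefP.not, DefP.mem, IsVar.proj, IsVar.const])
    ⟨hxa, w, hmem c₀ q₀ w hc₀ hq₀ (hg c₀ q₀ hq₀).2.1.2.1, hxw⟩
  obtain ⟨q, hq, hrq⟩ := (hW r).1 hr
  obtain ⟨-, c, hc, hcq⟩ := (hv' q).1 hq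
  -- As `c ∈ s`, the value at `s` bounds the one at `c` and so witnesses a failure at an element of
  -- `y`, contradicting minimality.
  obtain ⟨s, hs, hcs⟩ := hi c hc
  obtain ⟨q', hq'⟩ := hdom s hs
  obtain ⟨t, ht, w', hw', htw⟩ := (hg s q' hq').2.1.2.2.2 c hcs q hcq y hya ⟨r, hrq, hyr⟩
  exact hmin t ht ⟨ha.sub_of_mem hya t ht, w', hmem s q' w' hs hq' hw', htw⟩

end IsKPP

end Recursion

end PowerKP

theorem mainTheorem11 (σ : PowerKP.LSet.Sentence) (hσ : σ ∈ PowerKP.pi1PSetInduction) :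
    PowerKP.KPPAC.Proves σ :=
  Theory.proves_of_forall_models fun _ _ _ h =>
    PowerKP.models_pi1PSetInduction hσ (PowerKP.isKPP_of_models h).pi_induction
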